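/- Identify the unit circle $\mathbb T$ with $\mathbb R/2\pi\mathbb Z$, with arc length $m$; an arc is a nondegenerate interval of $\mathbb T$ ($\mathbb T$ itself included). A modular family $\mathbf\Phi$ consists of increasing (i.e. nondecreasing) functions $\Phi_x,\Phi_{I,+},\Phi_{I,-}:[0,\infty)\to[0,\infty)$, for every $x\in\mathbb T$ and every arc $I$, such that $\Phi_{I,-}\le\Phi_x\le\Phi_{I,+}$ for $x\in\overline I$, such that $\Phi_{I,\pm}=\Phi_{\overline I,\pm}$, such that $\Phi_{J,-}\le\Phi_{I,-}\le\Phi_{I,+}\le\Phi_{J,+}$ for $I\subset J$, and such that $x\mapsto\Phi_x(g(x))$ is (Lebesgue) measurable for every measurable $g:\mathbb T\to[0,\infty)$. Put $\Phi_x(\infty)=\sup_s\Phi_x(s)$ and $\rho_{\mathbf\Phi}(g)=\int_{\mathbb T}\Phi_t(|g(t)|)\,dt$. The family $\mathbf\Phi$ is - *slowly changing on intervals* if for every $B>0$ there is $C>0$ such that $\Phi_{I,+}(w)\le C\,\Phi_{I,-}(w)$ for every arc $I$ and every $w\ge0$ with $\Phi_{I,-}(w)\le B/m(I)$; - *convex*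 if all functions $\Phi_x,\Phi_{I,\pm}$ are convex; - *superlinear* if there is $K>0$ such that $\varphi(0)=0$ and $\varphi(s)\ge Ks$ for all $s\ge0$ and all $\varphi$ among the $\Phi_x,\Phi_{I,\pm}$; - *uniformly doubling* if there is $C'$ such that $\varphi(2s)\le C'\varphi(s)$ for all $s\ge0$ and all $\varphi$ among the $\Phi_x,\Phi_{I,\pm}$. Let $M_{HL}g(x)=\sup_{I\ni x}\frac1{m(I)}\int_I g$, the supremum over arcs $I$ containing $x$. For $f$ analytic in the unit disc $\mathbb D$ let $f^*(e^{i\theta})=\sup\{|f(re^{it})|:0\le r<1,\ |t-\theta|<(1-r)/2\}\in[0,\infty]$ be its nontangential maximal function, and let $$\rho_{H_{\Psi\circ\Phi\circ\log^+}}(f)=\sup_{0<r<1}\int_{\mathbb T}\Psi_t\bigl(\Phi_t(\log^+|f(re^{it})|)\bigr)\,dt .$$ **Theorem.** Let the modular family $\mathbf\Phi$ be slowly changing on intervals, convex and superlinear. Let $\mathbf\Psi$ be a uniformly doubling modular family for which the Hardy–Littlewood maximal operator is bounded in the sense that for every $A>0$ there is $B>0$ such that $\rho_{\mathbf\Psi}(M_{HL}g)\le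 B$ for all measurable $g:\mathbb T\to[0,\infty)$ with $\rho_{\mathbf\Psi}(g)\le A$. Then for every $A>0$ there is $B>0$ (depending only on $A$, $\mathbf\Phi$ and $\mathbf\Psi$) such that for every $f$ analytic in $\mathbb D$ $$\rho_{H_{\Psi\circ\Phi\circ\log^+}}(f)\le A\quad\Longrightarrow\quad\int_{\mathbb T}\Psi_t\bigl(\Phi_t(\log^+f^*(e^{it}))\bigr)\,dt\le B .$$ As a consequence, the nontangential maximal operator is bounded from $H^p$ to $L^p$: for every $0<p\le\infty$ there is $C<\infty$ such that $$\|f^*\|_{L^p(\mathbb T)}\le C\sup_{0<r<1}\|f(re^{i\cdot})\|_{L^p(\mathbb T)}$$ for every $f$ analytic in $\mathbb D$. -/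

import Mathlib

open MeasureTheory Set
open scoped NNReal ENNReal

noncomputable section

/-- The unit circle, parametrised by the angle `t ∈ ℝ / 2πℤ`, with arc length as measure. -/
abbrev UnitCirc : Type := AddCircle (2 * Real.pi)

instance fact_two_pi_pos_unitCirc : Fact (0 < 2 * Real.pi) := ⟨by positivity⟩

/-- The point `r e^{it}` of the complex plane. -/
def polarPt (r : ℝ) (t : UnitCirc) : ℂ := (r : ℂ) * (AddCircle.toCircle t : ℂ)

theorem polarPt_coe (r t : ℝ) :
    polarPt r (t : UnitCirc) = (r : ℂ) * Complex.exp (t * Complex.I) := by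
  have h : 2 * Real.pi / (2 * Real.pi) * t = t := by
    rw [div_self (by positivity), one_mul]
  rw [polarPt, AddCircle.toCircle_apply_mk, h, Circle.coe_exp]

/-- Nondegenerate arcs of the unit circle (open, half-open or closed, of length `b - a`, which is
at most `2π`; the whole circle is included). -/
def IsArc (I : Set UnitCirc) : Prop :=
  ∃ a b : ℝ, a < b ∧ b ≤ a + 2 * Real.pi ∧
    (fun t : ℝ => (t : UnitCirc)) '' Ioo a b ⊆ I ∧
    I ⊆ (fun t : ℝ => (t : UnitCirc)) '' Icc a b

/-- A modular family: increasing functions `Φ_x` (`fn x`) for every point `x` of the circle, and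
increasing functions `Φ_{I,+}` (`upper I`) and `Φ_{I,-}` (`lower I`) for every arc `I`.  The
values of `upper` and `lower` at sets that are not arcs are irrelevant and never used. -/
structure ModularFamily where
  fn : UnitCirc → ℝ≥0 → ℝ≥0
  upper : Set UnitCirc → ℝ≥0 → ℝ≥0
  lower : Set UnitCirc → ℝ≥0 → ℝ≥0
  fn_mono : ∀ x, Monotone (fn x)
  upper_mono : ∀ I, IsArc I → Monotone (upper I)
  lower_mono : ∀ I, IsArc I → Monotone (lower I)
  lower_le_fn : ∀ I, IsArc I → ∀ x ∈ closure I, ∀ t, lower I t ≤ fn x t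
  fn_le_upper : ∀ I, IsArc I → ∀ x ∈ closure I, ∀ t, fn x t ≤ upper I t
  upper_closure : ∀ I, IsArc I → upper (closure I) = upper I
  lower_closure : ∀ I, IsArc I → lower (closure I) = lower I
  upper_subset : ∀ I J, IsArc I → IsArc J → I ⊆ J → ∀ t, upper I t ≤ upper J t
  lower_subset : ∀ I J, IsArc I → IsArc J → I ⊆ J → ∀ t, lower J t ≤ lower I t
  /-- `x ↦ Φ_x (g x)` is measurable (up to a null set) for measurable `g`, so that the integrals
  defining the modular make sense. -/
  aemeasurable_fn : ∀ g : UnitCirc → ℝ≥0, Measurable g →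
    AEMeasurable (fun x => fn x (g x)) volume

namespace ModularFamily

/-- All the functions `Φ_x`, `Φ_{I,+}` and `Φ_{I,-}` of the family. -/
def members (Φ : ModularFamily) : Set (ℝ≥0 → ℝ≥0) :=
  {φ | (∃ x, φ = Φ.fn x) ∨ ∃ I, IsArc I ∧ (φ = Φ.upper I ∨ φ = Φ.lower I)}

/-- `Φ(2λ) ≤ C' Φ(λ)` with one constant for the whole family. -/
def UniformlyDoubling (Φ : ModularFamily) : Prop :=
  ∃ C : ℝ≥0, ∀ φ ∈ Φ.members, ∀ t, φ (2 * t) ≤ C * φ t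

def IsConvex (Φ : ModularFamily) : Prop :=
  ∀ φ ∈ Φ.members, ConvexOn ℝ≥0 univ φ

def Superlinear (Φ : ModularFamily) : Prop :=
  ∃ K : ℝ≥0, 0 < K ∧ ∀ φ ∈ Φ.members, φ 0 = 0 ∧ ∀ t, K * t ≤ φ t

/-- Slowly changing on intervals: for each `B > 0` there is `C > 0` such that
`Φ_{I,+}(w) ≤ C Φ_{I,-}(w)` for every arc `I` and every `w ≤ Φ_{I,-}⁻¹(B / m(I))`, that is, every
`w` with `Φ_{I,-}(w) ≤ B / m(I)`. -/
def SlowlyChanging (Φ : ModularFamily) : Prop :=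
  ∀ B : ℝ≥0, 0 < B → ∃ C : ℝ≥0, 0 < C ∧ ∀ I, IsArc I → ∀ w : ℝ≥0,
    (Φ.lower I w : ℝ≥0∞) ≤ B / volume I → Φ.upper I w ≤ C * Φ.lower I w

/-- `Φ_x(t)` for `t ∈ [0, ∞]`: the usual value for finite `t`, and `Φ_x(∞) = sup_s Φ_x(s)`. -/
def eval (Φ : ModularFamily) (x : UnitCirc) (t : ℝ≥0∞) : ℝ≥0∞ :=
  ⨆ (s : ℝ≥0) (_ : (s : ℝ≥0∞) ≤ t), (Φ.fn x s : ℝ≥0∞)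

theorem eval_coe (Φ : ModularFamily) (x : UnitCirc) (t : ℝ≥0) :
    Φ.eval x (t : ℝ≥0∞) = Φ.fn x t := by
  apply le_antisymm
  · exact iSup₂_le fun s hs =>
      ENNReal.coe_le_coe.mpr (Φ.fn_mono x (ENNReal.coe_le_coe.mp hs))
  · exact le_iSup₂_of_le t le_rfl le_rfl

/-- The modular `ρ_Φ(g) = ∫ Φ_x(g(x)) dx` of a function with values in `[0, ∞]`. -/
def modular (Φ : ModularFamily) (g : UnitCirc → ℝ≥0∞) : ℝ≥0∞ :=
  ∫⁻ x, Φ.eval x (g x)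

/-- `ρ_{H_Φ}(f) = sup_{0<r<1} ρ_Φ(|f(r e^{i·})|)`. -/
def hardyModular (Φ : ModularFamily) (f : ℂ → ℂ) : ℝ≥0∞ :=
  ⨆ (r : ℝ) (_ : r ∈ Ioo (0 : ℝ) 1), Φ.modular (fun x => ‖f (polarPt r x)‖ₑ)

/-- The family `Ψ ∘ Φ` of the functions `Ψ_x ∘ Φ_x`. -/
def comp (Ψ Φ : ModularFamily) : ModularFamily where
  fn x t := Ψ.fn x (Φ.fn x t)
  upper I t := Ψ.upper I (Φ.upper I t)
  lower I t := Ψ.lower I (Φ.lower I t)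
  fn_mono x := (Ψ.fn_mono x).comp (Φ.fn_mono x)
  upper_mono I hI := (Ψ.upper_mono I hI).comp (Φ.upper_mono I hI)
  lower_mono I hI := (Ψ.lower_mono I hI).comp (Φ.lower_mono I hI)
  lower_le_fn I hI x hx t :=
    (Ψ.lower_le_fn I hI x hx _).trans (Ψ.fn_mono x (Φ.lower_le_fn I hI x hx t))
  fn_le_upper I hI x hx t :=
    (Ψ.fn_mono x (Φ.fn_le_upper I hI x hx t)).trans (Ψ.fn_le_upper I hI x hx _)
  upper_closure I hI := by rw [Ψ.upper_closure I hI, Φ.upper_closure I hI]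
  lower_closure I hI := by rw [Ψ.lower_closure I hI, Φ.lower_closure I hI]
  upper_subset I J hI hJ h t :=
    (Ψ.upper_mono I hI (Φ.upper_subset I J hI hJ h t)).trans (Ψ.upper_subset I J hI hJ h _)
  lower_subset I J hI hJ h t :=
    (Ψ.lower_mono J hJ (Φ.lower_subset I J hI hJ h t)).trans (Ψ.lower_subset I J hI hJ h _)
  aemeasurable_fn g hg := by
    have h := Φ.aemeasurable_fn g hg
    refine (Ψ.aemeasurable_fn (h.mk _) h.measurable_mk).congr ?_
    filter_upwards [h.ae_eq_mk] with x hx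
    rw [← hx]

/-- The function `log⁺`, as a modular family that does not depend on the point. -/
def logPlus : ModularFamily where
  fn _ t := (Real.posLog t).toNNReal
  upper _ t := (Real.posLog t).toNNReal
  lower _ t := (Real.posLog t).toNNReal
  fn_mono _ s t h := Real.toNNReal_le_toNNReal
    (Real.monotoneOn_posLog s.coe_nonneg t.coe_nonneg (NNReal.coe_le_coe.mpr h))
  upper_mono _ _ s t h := Real.toNNReal_le_toNNReal
    (Real.monotoneOn_posLog s.coe_nonneg t.coe_nonneg (NNReal.coe_le_coe.mpr h))
  lower_mono _ _ s t h := Real.toNNReal_le_toNNReal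
    (Real.monotoneOn_posLog s.coe_nonneg t.coe_nonneg (NNReal.coe_le_coe.mpr h))
  lower_le_fn _ _ _ _ _ := le_rfl
  fn_le_upper _ _ _ _ _ := le_rfl
  upper_closure _ _ := rfl
  lower_closure _ _ := rfl
  upper_subset _ _ _ _ _ _ := le_rfl
  lower_subset _ _ _ _ _ _ := le_rfl
  aemeasurable_fn g hg := by
    have h : Measurable Real.posLog := by
      unfold Real.posLog
      exact measurable_const.max Real.measurable_log
    exact ((h.comp hg.coe_nnreal_real).real_toNNReal).aemeasurable

end ModularFamily

/-- The (uncentred) Hardy-Littlewood maximal function: the supremum of the averages over the arcs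
containing the given point. -/
def hlMax (g : UnitCirc → ℝ≥0∞) (x : UnitCirc) : ℝ≥0∞ :=
  ⨆ (I : Set UnitCirc) (_ : IsArc I ∧ x ∈ I), (volume I)⁻¹ * ∫⁻ y in I, g y

/-- The Hardy-Littlewood maximal operator is bounded for the modular of `Ψ`. -/
def HLBounded (Ψ : ModularFamily) : Prop :=
  ∀ A : ℝ≥0, 0 < A → ∃ B : ℝ≥0, 0 < B ∧ ∀ g : UnitCirc → ℝ≥0, Measurable g →
    Ψ.modular (fun x => (g x : ℝ≥0∞)) ≤ A →
    Ψ.modular (hlMax fun x => (g x : ℝ≥0∞)) ≤ B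

/-- The nontangential approach region `Γ_θ = {r e^{it} : 0 ≤ r < 1, |t - θ| < (1 - r) / 2}`. -/
def approachRegion (θ : UnitCirc) : Set ℂ :=
  {z | ∃ r s : ℝ, 0 ≤ r ∧ r < 1 ∧ |s| < (1 - r) / 2 ∧ z = polarPt r (θ + (s : UnitCirc))}

/-- The nontangential maximal function `f^*(e^{iθ}) = sup_{z ∈ Γ_θ} |f(z)| ∈ [0, ∞]`. -/
def ntMax (f : ℂ → ℂ) (θ : UnitCirc) : ℝ≥0∞ :=
  ⨆ z ∈ approachRegion θ, ‖f z‖ₑ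

/-- The `H^p` (quasi-)norm `sup_{0<r<1} ‖f(r e^{i·})‖_{L^p}`. -/
def hardyNorm (p : ℝ≥0∞) (f : ℂ → ℂ) : ℝ≥0∞ :=
  ⨆ (r : ℝ) (_ : r ∈ Ioo (0 : ℝ) 1), eLpNorm (fun x : UnitCirc => f (polarPt r x)) p volume

end

/-! Fix `x`, a point `w` of the approach region at `x`, and put `u = log⁺|f(r ·)|` on the circle,
with Poisson integral at least `y = log⁺|f(r w)|` at `w`. Seen from `w`, the Poisson kernel is
constant up to a factor on each of finitely many dyadic annuli around `x`. Since `y` is at most the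
Poisson average of `u`, it is at most the average over one of these annuli (pigeonhole). Let `I` be
the arc centred at `x` that encloses this annulus. Jensen's inequality for the single convex
function `Φ_{I,-}`, followed by the change from Poisson to arc length, bounds `Φ_{I,-}(y)` by a
constant times the average of `Φ_t(u(t))` over `I`. If `∫ Φ_t(u(t)) dt ≤ D`, this average is at most
`D / m(I)`. That is exactly the range where slow change replaces `Φ_{I,-}(y)` by `Φ_{I,+}(y) ≥
Φ_x(y)`. Hence `Φ_x(y)` is dominated by the maximal function of `Φ_t(u(t))` at `x`
(`exists_fn_le_mul_dyadicMax`).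

The bound `D` comes from the boundedness of the maximal operator: if functions of modular at most
`A` had unbounded integrals, their maximal functions would exceed every constant, and the modular of
`Ψ` would be bounded outright (`exists_lintegral_le_or_forall_modular_le`). Doubling of `Ψ` absorbs
the constant, and Fatou's lemma lets `r → 1` (`exists_lintegral_ntMax_le`).

For `H^p` with finite `p`, take `Ψ(s) = s²` and `Φ(s) = exp(ps/2) - 1`, so that `Ψ ∘ Φ ∘ log⁺` is
comparable to `s^p` up to additive constants; the maximal operator is bounded on `L²`, and
homogeneity removes the additive constants. The case `p = ∞` is the maximum principle. -/

noncomputable section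

/-! ### Polar coordinates and approximation on the circle -/

theorem norm_polarPt (r : ℝ) (t : UnitCirc) : ‖polarPt r t‖ = |r| := by
  rw [polarPt, norm_mul, Circle.norm_coe, mul_one, Complex.norm_real, Real.norm_eq_abs]

@[simp]
theorem norm_polarPt_one (t : UnitCirc) : ‖polarPt 1 t‖ = 1 := by
  rw [norm_polarPt, abs_one]

theorem polarPt_eq_mul_polarPt_one (r : ℝ) (t : UnitCirc) :
    polarPt r t = r * polarPt 1 t := by
  simp [polarPt]

theorem continuous_polarPt (r : ℝ) : Continuous (polarPt r) :=
  continuous_const.mul (continuous_subtype_val.comp AddCircle.continuous_toCircle)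

theorem exists_polarPt_one_eq {z : ℂ} (hz : ‖z‖ = 1) : ∃ t : UnitCirc, polarPt 1 t = z := by
  refine ⟨(Complex.arg z : ℝ), ?_⟩
  rw [polarPt_coe]
  simpa [hz] using Complex.norm_mul_exp_arg_mul_I z

theorem circleMap_eq_polarPt (θ : ℝ) : circleMap 0 1 θ = polarPt 1 (θ : UnitCirc) := by
  rw [polarPt_coe, circleMap_zero]

theorem circleAverage_eq_integral (f : ℂ → ℝ) :
    Real.circleAverage f 0 1 = (2 * Real.pi)⁻¹ * ∫ t : UnitCirc, f (polarPt 1 t) := by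
  have h := AddCircle.intervalIntegral_preimage (2 * Real.pi) 0
    (fun t : UnitCirc => f (polarPt 1 t))
  rw [zero_add] at h
  rw [Real.circleAverage, ← h, smul_eq_mul]
  simp only [circleMap_eq_polarPt]

/-- Every continuous real function on the circle is uniformly close to the real part of an entire
function. -/
theorem exists_differentiable_re_near (h : C(UnitCirc, ℝ)) {ε : ℝ} (hε : 0 < ε) :
    ∃ Q : ℂ → ℂ, Differentiable ℂ Q ∧ ∀ t : UnitCirc, |(Q (polarPt 1 t)).re - h t| < ε := by
  let S : Submodule ℂ C(UnitCirc, ℂ) :=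
    { carrier := {g | ∃ P Q : ℂ → ℂ, Differentiable ℂ P ∧ Differentiable ℂ Q ∧
        ∀ t, g t = P (polarPt 1 t) + starRingEnd ℂ (Q (polarPt 1 t))}
      add_mem' := by
        rintro a b ⟨P, Q, hP, hQ, h⟩ ⟨P', Q', hP', hQ', h'⟩
        refine ⟨P + P', Q + Q', hP.add hP', hQ.add hQ', fun t => ?_⟩
        simp only [ContinuousMap.add_apply, h, h', Pi.add_apply, map_add]
        ring
      zero_mem' := ⟨0, 0, differentiable_const 0, differentiable_const 0, fun t => by simp⟩
      smul_mem' := by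
        rintro c a ⟨P, Q, hP, hQ, h⟩
        refine ⟨fun z => c * P z, fun z => starRingEnd ℂ c * Q z, hP.const_mul _,
          hQ.const_mul _, fun t => ?_⟩
        simp only [ContinuousMap.smul_apply, h, smul_eq_mul, map_mul, Complex.conj_conj]
        ring }
  have hS : Submodule.span ℂ (range (@fourier (2 * Real.pi))) ≤ S := by
    rw [Submodule.span_le]
    rintro _ ⟨n, rfl⟩
    obtain ⟨m, rfl | rfl⟩ := n.eq_nat_or_neg
    · exact ⟨fun z => z ^ m, fun _ => 0, differentiable_id.pow m, differentiable_const _,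
        fun t => by simp [polarPt, fourier_apply, AddCircle.toCircle_nsmul]⟩
    · exact ⟨fun _ => 0, fun z => z ^ m, differentiable_const _, differentiable_id.pow m,
        fun t => by
          simp [polarPt, fourier_apply, AddCircle.toCircle_nsmul, AddCircle.toCircle_neg,
            ← Circle.coe_inv_eq_conj]⟩
  let hc : C(UnitCirc, ℂ) := ⟨fun t => (h t : ℂ), Complex.continuous_ofReal.comp h.continuous⟩
  have hmem : hc ∈ closure (Submodule.span ℂ (range (@fourier (2 * Real.pi))) :
      Set C(UnitCirc, ℂ)) := by
    have := Submodule.mem_top (R := ℂ) (x := hc)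
    rw [← span_fourier_closure_eq_top] at this
    exact this
  obtain ⟨g, hg, hd⟩ := Metric.mem_closure_iff.mp hmem ε hε
  obtain ⟨P, Q, hP, hQ, hPQ⟩ := hS hg
  -- Conjugation does not change real parts, so `P + conj Q` and the entire function `P + Q` have
  -- the same real part on the circle.
  refine ⟨P + Q, hP.add hQ, fun t => ?_⟩
  have h1 : ‖(g - hc) t‖ < ε := by
    refine ((g - hc).norm_coe_le_norm t).trans_lt ?_
    rwa [← dist_eq_norm, dist_comm]
  have h2 := (Complex.abs_re_le_norm ((g - hc) t)).trans_lt h1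
  simpa [hc, hPQ] using h2

/-! ### Poisson integrals and the majorisation of `log⁺ |F|` -/

/-- The Poisson measure (harmonic measure) on the circle at a point of the disc. -/
def poissonMeasure (w : ℂ) : Measure UnitCirc :=
  volume.withDensity fun t =>
    ENNReal.ofReal ((2 * Real.pi)⁻¹ * poissonKernel 0 w (polarPt 1 t))

theorem poissonKernel_polarPt {w : ℂ} (t : UnitCirc) :
    poissonKernel 0 w (polarPt 1 t) = (1 - ‖w‖ ^ 2) / ‖(polarPt 1 t) - w‖ ^ 2 := by
  simp [poissonKernel_def]

theorem poissonKernel_polarPt_nonneg {w : ℂ} (hw : ‖w‖ < 1) (t : UnitCirc) :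
    0 ≤ poissonKernel 0 w (polarPt 1 t) := by
  rw [poissonKernel_polarPt]
  have : ‖w‖ ^ 2 ≤ 1 := pow_le_one₀ (norm_nonneg _) hw.le
  exact div_nonneg (by linarith) (by positivity)

theorem polarPt_sub_ne_zero {w : ℂ} (hw : ‖w‖ < 1) (t : UnitCirc) :
    (polarPt 1 t) - w ≠ 0 := by
  intro h
  rw [sub_eq_zero] at h
  rw [← h, norm_polarPt_one] at hw
  exact lt_irrefl _ hw

theorem continuous_poissonKernel_polarPt {w : ℂ} (hw : ‖w‖ < 1) :
    Continuous fun t : UnitCirc => poissonKernel 0 w (polarPt 1 t) := by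
  simp only [poissonKernel_polarPt]
  refine continuous_const.div (((continuous_polarPt 1).sub continuous_const).norm.pow 2)
    fun t => ?_
  exact pow_ne_zero 2 (norm_ne_zero_iff.mpr (polarPt_sub_ne_zero hw t))

theorem integral_poissonMeasure {w : ℂ} (hw : ‖w‖ < 1) (u : UnitCirc → ℝ) :
    ∫ t, u t ∂poissonMeasure w =
      (2 * Real.pi)⁻¹ * ∫ t : UnitCirc, poissonKernel 0 w (polarPt 1 t) * u t := by
  rw [poissonMeasure, integral_withDensity_eq_integral_toReal_smul
    ((continuous_poissonKernel_polarPt hw).const_mul _).measurable.ennreal_ofReal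
    (by simp), ← integral_const_mul]
  congr 1 with t
  rw [ENNReal.toReal_ofReal (mul_nonneg (by positivity) (poissonKernel_polarPt_nonneg hw t)),
    smul_eq_mul, mul_assoc]

/-- Real part of the Poisson formula for `Q`; taking `Q = 1` gives the total mass of the Poisson
measure. -/
theorem integral_poissonMeasure_re {w : ℂ} (hw : ‖w‖ < 1) {Q : ℂ → ℂ} (hQ : Differentiable ℂ Q) :
    ∫ t : UnitCirc, (Q (polarPt 1 t)).re ∂poissonMeasure w = (Q w).re := by
  have h := hQ.diffContOnCl.circleAverage_poissonKernel_smul (c := 0) (R := 1)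
    (w := w) (by simpa using hw)
  have h2 := Complex.reCLM.circleAverage_comp_comm
    (f := poissonKernel 0 w • Q) (c := 0) (R := 1) (by
      refine ContinuousOn.circleIntegrable' ?_
      refine ContinuousOn.smul ?_ hQ.continuous.continuousOn
      rw [poissonKernel_eq_re_herglotzRieszKernel]
      exact Complex.continuous_re.comp_continuousOn
        (continuousOn_herglotzRieszKernel_sphere (by simpa using hw)))
  rw [h, circleAverage_eq_integral] at h2
  rw [integral_poissonMeasure hw, ← Complex.reCLM_apply, ← h2]
  simp

theorem isProbabilityMeasure_poissonMeasure {w : ℂ} (hw : ‖w‖ < 1) :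
    IsProbabilityMeasure (poissonMeasure w) := by
  have h := integral_poissonMeasure_re hw (differentiable_const (1 : ℂ))
  simp only [Complex.one_re, integral_const, smul_eq_mul, mul_one, measureReal_def] at h
  refine ⟨?_⟩
  rw [← ENNReal.ofReal_toReal (a := poissonMeasure w univ) (by intro h'; simp [h'] at h), h,
    ENNReal.ofReal_one]

/-- The function `log⁺ |F|` lies below its Poisson integral. -/
theorem posLog_norm_le_integral_poissonMeasure {F : ℂ → ℂ} (hF : DiffContOnCl ℂ F (Metric.ball 0 1))
    {w : ℂ} (hw : ‖w‖ < 1) :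
    Real.posLog ‖F w‖ ≤ ∫ t : UnitCirc, Real.posLog ‖F (polarPt 1 t)‖ ∂poissonMeasure w := by
  have := isProbabilityMeasure_poissonMeasure hw
  have hcF : Continuous fun t : UnitCirc => F (polarPt 1 t) := by
    refine hF.continuousOn.comp_continuous (continuous_polarPt 1) fun t => ?_
    rw [closure_ball _ one_ne_zero]
    simp
  let h : C(UnitCirc, ℝ) := ⟨fun t => Real.posLog ‖F (polarPt 1 t)‖, Real.continuous_posLog.comp hcF.norm⟩
  have hint : ∀ u : UnitCirc → ℝ, Continuous u → Integrable u (poissonMeasure w) := fun u hu => by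
    obtain ⟨C, hC⟩ := isCompact_univ.exists_bound_of_continuousOn hu.continuousOn
    exact Integrable.of_bound hu.aestronglyMeasurable C (.of_forall fun t => hC t trivial)
  refine le_of_forall_pos_le_add fun ε hε => ?_
  -- Shifting by `ε / 2` before approximating within `ε / 2` puts `Re Q` between `log⁺ |F|` and
  -- `log⁺ |F| + ε` on the circle.
  let h' : C(UnitCirc, ℝ) := ⟨fun t => h t + ε / 2, h.continuous.add continuous_const⟩
  obtain ⟨Q, hQ, hQh⟩ := exists_differentiable_re_near h' (half_pos hε)
  have hlow : ∀ t : UnitCirc, Real.posLog ‖F (polarPt 1 t)‖ ≤ (Q (polarPt 1 t)).re := fun t => by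
    have := (abs_lt.mp (hQh t)).1
    change _ < _ - (Real.posLog ‖F (polarPt 1 t)‖ + ε / 2) at this
    linarith
  have hupp : ∀ t : UnitCirc, (Q (polarPt 1 t)).re ≤ Real.posLog ‖F (polarPt 1 t)‖ + ε := fun t => by
    have := (abs_lt.mp (hQh t)).2
    change _ - (Real.posLog ‖F (polarPt 1 t)‖ + ε / 2) < _ at this
    linarith
  have hcQ : Continuous fun t : UnitCirc => (Q (polarPt 1 t)).re :=
    Complex.continuous_re.comp (hQ.continuous.comp (continuous_polarPt 1))
  have hQw : (Q w).re ≤ ∫ t : UnitCirc, Real.posLog ‖F (polarPt 1 t)‖ ∂poissonMeasure w + ε := by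
    rw [← integral_poissonMeasure_re hw hQ]
    calc _ ≤ ∫ t : UnitCirc, (Real.posLog ‖F (polarPt 1 t)‖ + ε) ∂poissonMeasure w :=
          integral_mono (hint _ hcQ) (hint _ (h.continuous.add continuous_const)) hupp
      _ = _ := by 
          refine (integral_add (hint _ h.continuous) (integrable_const _)).trans ?_
          simp [h]
  have hQ0 : 0 ≤ (Q w).re := by
    rw [← integral_poissonMeasure_re hw hQ]
    exact integral_nonneg fun t => Real.posLog_nonneg.trans (hlow t)
  refine le_trans ?_ hQw
  -- The maximum principle for `F e^{-Q}` replaces subharmonicity: on the circle `log |F| ≤ Re Q`,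
  -- so the modulus is at most 1 there.
  have hmax : ‖F w * Complex.exp (-Q w)‖ ≤ 1 := by
    refine Complex.norm_le_of_forall_mem_frontier_norm_le (f := fun z => F z * Complex.exp (-Q z))
      Metric.isBounded_ball (hF.smul (hQ.neg.cexp.diffContOnCl)) ?_ (subset_closure (by simpa using hw))
    intro z hz
    rw [frontier_ball _ one_ne_zero, mem_sphere_zero_iff_norm] at hz
    obtain ⟨t, rfl⟩ := exists_polarPt_one_eq hz
    rw [norm_mul, Complex.norm_exp, Complex.neg_re]
    rcases eq_or_ne (F (polarPt 1 t)) 0 with h0 | h0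
    · simp [h0]
    rw [← Real.exp_log (norm_pos_iff.mpr h0), ← Real.exp_add, Real.exp_le_one_iff]
    have := (le_max_right 0 (Real.log ‖F (polarPt 1 t)‖)).trans (hlow t)
    linarith
  rcases eq_or_ne (F w) 0 with h0 | h0
  · simpa [h0] using hQ0
  rw [norm_mul, Complex.norm_exp, Complex.neg_re, ← Real.exp_log (norm_pos_iff.mpr h0),
    ← Real.exp_add, Real.exp_le_one_iff] at hmax
  exact max_le hQ0 (by linarith)

/-! ### Arcs, chords and approach regions -/

namespace UnitCirc

theorem exists_coe_eq_abs_eq_norm (y : UnitCirc) : ∃ s : ℝ, (s : UnitCirc) = y ∧ |s| = ‖y‖ := by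
  induction y using QuotientAddGroup.induction_on with
  | H x =>
    refine ⟨x - round ((2 * Real.pi)⁻¹ * x) * (2 * Real.pi), ?_, (AddCircle.norm_eq _).symm⟩
    rw [AddCircle.coe_sub, ← zsmul_eq_mul, AddCircle.coe_zsmul, AddCircle.coe_period]
    simp

theorem norm_coe_le (s : ℝ) : ‖(s : UnitCirc)‖ ≤ |s| := by
  exact (QuotientAddGroup.norm_mk_le_norm : ‖(s : UnitCirc)‖ ≤ ‖s‖)

theorem norm_le_pi (y : UnitCirc) : ‖y‖ ≤ Real.pi := by
  have := AddCircle.norm_le_half_period (2 * Real.pi) (x := y) (by positivity)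
  rwa [abs_of_pos (by positivity), mul_div_cancel_left₀ _ two_ne_zero] at this

theorem volume_closedBall {x : UnitCirc} {δ : ℝ} (h : δ ≤ Real.pi) :
    volume (Metric.closedBall x δ) = ENNReal.ofReal (2 * δ) := by
  rw [AddCircle.volume_closedBall, min_eq_right (by linarith)]

theorem isArc_closedBall (x : UnitCirc) {δ : ℝ} (h0 : 0 < δ) (h : δ ≤ Real.pi) :
    IsArc (Metric.closedBall x δ) := by
  induction x using QuotientAddGroup.induction_on with
  | H x =>
    refine ⟨x - δ, x + δ, by linarith, by linarith, ?_, ?_⟩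
    · rintro _ ⟨t, ht, rfl⟩
      rw [mem_closedBall_iff_norm]
      refine (norm_coe_le (t - x)).trans ?_
      rw [abs_le]
      constructor <;> linarith [ht.1, ht.2]
    · intro y hy
      obtain ⟨s, hs, hs'⟩ := exists_coe_eq_abs_eq_norm (y - (x : UnitCirc))
      rw [mem_closedBall_iff_norm, ← hs', abs_le] at hy
      refine ⟨x + s, ⟨by linarith, by linarith⟩, ?_⟩
      change ((x + s : ℝ) : UnitCirc) = y
      rw [AddCircle.coe_add, hs]
      exact add_sub_cancel _ _

theorem norm_polarPt_one_sub_one_eq (s : ℝ) :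
    ‖polarPt 1 (s : UnitCirc) - 1‖ = 2 * |Real.sin (s / 2)| := by
  rw [polarPt_coe, Complex.ofReal_one, one_mul, mul_comm, Complex.norm_exp_I_mul_ofReal_sub_one]
  simp

theorem norm_polarPt_one_sub (s t : UnitCirc) :
    ‖polarPt 1 s - polarPt 1 t‖ = ‖polarPt 1 (s - t) - 1‖ := by
  have h : polarPt 1 s = polarPt 1 (s - t) * polarPt 1 t := by
    have := AddCircle.toCircle_add (s - t) t
    rw [sub_add_cancel] at this
    simp [polarPt, this]
  have h2 : polarPt 1 s - polarPt 1 t = (polarPt 1 (s - t) - 1) * polarPt 1 t := by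
    rw [h]; ring
  rw [h2, norm_mul, norm_polarPt_one, mul_one]

theorem norm_polarPt_one_sub_le (s t : UnitCirc) : ‖polarPt 1 s - polarPt 1 t‖ ≤ ‖s - t‖ := by
  obtain ⟨a, ha, ha'⟩ := exists_coe_eq_abs_eq_norm (s - t)
  rw [norm_polarPt_one_sub, ← ha', ← ha, norm_polarPt_one_sub_one_eq]
  have := Real.abs_sin_le_abs (x := a / 2)
  rw [abs_div, abs_two] at this
  linarith

/-- The chord is `2 |sin (a / 2)|` with `|a| ≤ π`, so Jordan's inequality applies. -/
theorem le_norm_polarPt_one_sub (s t : UnitCirc) :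
    2 / Real.pi * ‖s - t‖ ≤ ‖polarPt 1 s - polarPt 1 t‖ := by
  obtain ⟨a, ha, ha'⟩ := exists_coe_eq_abs_eq_norm (s - t)
  have hπ := norm_le_pi (s - t)
  rw [norm_polarPt_one_sub, ← ha', ← ha, norm_polarPt_one_sub_one_eq]
  rw [← ha'] at hπ
  have := Real.mul_abs_le_abs_sin (x := a / 2) (by rw [abs_div, abs_two]; linarith)
  rw [abs_div, abs_two] at this
  linarith

end UnitCirc

theorem norm_lt_one_of_mem_approachRegion {x : UnitCirc} {w : ℂ} (hw : w ∈ approachRegion x) :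
    ‖w‖ < 1 := by
  obtain ⟨r, s, h0, h1, -, rfl⟩ := hw
  rwa [norm_polarPt, abs_of_nonneg h0]

/-- Seen from a point `w` of the approach region at `x`, the point `e^{it}` has a distance
comparable to `1 - ‖w‖` plus the distance from `t` to `x`. -/
theorem norm_polarPt_one_sub_le_of_mem_approachRegion {x : UnitCirc} {w : ℂ}
    (hw : w ∈ approachRegion x) (t : UnitCirc) :
    ‖polarPt 1 t - w‖ ≤ ‖t - x‖ + 3 / 2 * (1 - ‖w‖) := by
  obtain ⟨r, s, h0, h1, hs, rfl⟩ := hw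
  rw [norm_polarPt, abs_of_nonneg h0]
  have e1 := UnitCirc.norm_polarPt_one_sub_le t (x + s)
  have e2 : ‖polarPt 1 (x + s) - polarPt r (x + s)‖ = 1 - r := by
    rw [polarPt_eq_mul_polarPt_one r, ← one_sub_mul, norm_mul, norm_polarPt_one, mul_one,
      ← Complex.ofReal_one, ← Complex.ofReal_sub, Complex.norm_real, Real.norm_eq_abs,
      abs_of_pos (by linarith)]
  have e3 := norm_sub_le_norm_sub_add_norm_sub (polarPt 1 t) (polarPt 1 (x + s)) (polarPt r (x + s))
  have e4 : ‖t - (x + s)‖ ≤ ‖t - x‖ + ‖(s : UnitCirc)‖ := by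
    rw [← sub_sub]; exact norm_sub_le _ _
  linarith [UnitCirc.norm_coe_le s]

theorem one_sub_norm_le (t : UnitCirc) (w : ℂ) : 1 - ‖w‖ ≤ ‖polarPt 1 t - w‖ := by
  simpa using norm_sub_norm_le (polarPt 1 t) w

/-- With `d = |e^{it} - w|`, one has `1 - r ≤ d`. The chord from `e^{it}` to the radial projection
of `w` is then at most `2d`, hence the arc at most `πd`; the aperture adds `|s| < d / 2`, and `π +
1/2 < 4`. -/
theorem norm_sub_le_of_mem_approachRegion {x : UnitCirc} {w : ℂ}
    (hw : w ∈ approachRegion x) (t : UnitCirc) :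
    ‖t - x‖ ≤ 4 * ‖polarPt 1 t - w‖ := by
  have e0 := one_sub_norm_le t w
  obtain ⟨r, s, h0, h1, hs, rfl⟩ := hw
  rw [norm_polarPt, abs_of_nonneg h0] at e0
  have e1 := UnitCirc.le_norm_polarPt_one_sub t (x + s)
  have e2 : ‖polarPt r (x + s) - polarPt 1 (x + s)‖ = 1 - r := by
    rw [norm_sub_rev, polarPt_eq_mul_polarPt_one r, ← one_sub_mul, norm_mul, norm_polarPt_one,
      mul_one, ← Complex.ofReal_one, ← Complex.ofReal_sub, Complex.norm_real, Real.norm_eq_abs,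
      abs_of_pos (by linarith)]
  have e3 := norm_sub_le_norm_sub_add_norm_sub (polarPt 1 t) (polarPt r (x + s)) (polarPt 1 (x + s))
  have e4 : ‖t - x‖ ≤ ‖t - (x + s)‖ + ‖(s : UnitCirc)‖ := by
    have := norm_add_le (t - (x + s)) (s : UnitCirc)
    rwa [show t - (x + (s : UnitCirc)) + s = t - x by abel] at this
  have e5 : ‖t - (x + s)‖ ≤ Real.pi / 2 * ‖polarPt 1 t - polarPt 1 (x + s)‖ := by
    calc _ = Real.pi / 2 * (2 / Real.pi * ‖t - (x + s)‖) := by field_simp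
      _ ≤ _ := by gcongr
  have hπ := Real.pi_lt_d2
  have e6 : Real.pi / 2 * ‖polarPt 1 t - polarPt 1 (x + s)‖ ≤
      1.575 * (2 * ‖polarPt 1 t - polarPt r (x + s)‖) := by
    gcongr <;> linarith
  linarith [UnitCirc.norm_coe_le s]

/-! ### Dyadic annuli and the size of the Poisson kernel -/

/-- The radii `π 2^{-k}`. -/
def dyadicRadius (k : ℕ) : ℝ := Real.pi / 2 ^ k

theorem dyadicRadius_pos (k : ℕ) : 0 < dyadicRadius k := by
  unfold dyadicRadius; positivity

theorem dyadicRadius_succ (k : ℕ) : dyadicRadius (k + 1) = dyadicRadius k / 2 := by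
  unfold dyadicRadius; rw [pow_succ]; field_simp

theorem dyadicRadius_zero : dyadicRadius 0 = Real.pi := by simp [dyadicRadius]

theorem dyadicRadius_anti {j k : ℕ} (h : j ≤ k) : dyadicRadius k ≤ dyadicRadius j := by
  induction h with
  | refl => rfl
  | step _ ih =>
    refine le_trans ?_ ih
    rw [dyadicRadius_succ]
    linarith [dyadicRadius_pos ‹_›]

theorem dyadicRadius_le_pi (k : ℕ) : dyadicRadius k ≤ Real.pi :=
  dyadicRadius_zero ▸ dyadicRadius_anti k.zero_le

theorem exists_dyadicRadius_mem_Ioc {h : ℝ} (h0 : 0 < h) (h1 : h ≤ Real.pi) :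
    ∃ N, h ≤ dyadicRadius N ∧ dyadicRadius N < 2 * h := by
  have hex : ∃ n, dyadicRadius n < 2 * h := by
    obtain ⟨n, hn⟩ := pow_unbounded_of_one_lt (Real.pi / (2 * h)) one_lt_two
    refine ⟨n, ?_⟩
    rw [dyadicRadius, div_lt_iff₀ (by positivity), mul_comm]
    rwa [div_lt_iff₀ (by positivity)] at hn
  classical
  refine ⟨Nat.find hex, ?_, Nat.find_spec hex⟩
  rcases hn : Nat.find hex with _ | m
  · rwa [dyadicRadius_zero]
  · have := Nat.find_min hex (m := m) (by omega)
    rw [dyadicRadius_succ]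
    linarith

theorem isArc_closedBall_dyadicRadius (x : UnitCirc) (k : ℕ) :
    IsArc (Metric.closedBall x (dyadicRadius k)) :=
  UnitCirc.isArc_closedBall x (dyadicRadius_pos k) (dyadicRadius_le_pi k)

theorem volume_closedBall_dyadicRadius (x : UnitCirc) (k : ℕ) :
    volume (Metric.closedBall x (dyadicRadius k)) = ENNReal.ofReal (2 * dyadicRadius k) :=
  UnitCirc.volume_closedBall (dyadicRadius_le_pi k)

/-- The dyadic annuli around `x`, the innermost one being a full arc of radius `π 2^{-N}`. -/
def dyadicAnnulus (x : UnitCirc) (N k : ℕ) : Set UnitCirc :=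
  {t | ‖t - x‖ ≤ dyadicRadius k ∧ (k < N → dyadicRadius (k + 1) < ‖t - x‖)}

theorem dyadicAnnulus_subset (x : UnitCirc) (N k : ℕ) :
    dyadicAnnulus x N k ⊆ Metric.closedBall x (dyadicRadius k) := fun t ht => by
  rw [mem_closedBall_iff_norm]; exact ht.1

theorem measurableSet_dyadicAnnulus (x : UnitCirc) (N k : ℕ) :
    MeasurableSet (dyadicAnnulus x N k) := by
  have hm : Measurable fun t : UnitCirc => ‖t - x‖ := by fun_prop
  by_cases hk : k < N
  · simp only [dyadicAnnulus, hk, true_imp_iff]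
    exact (measurableSet_le hm measurable_const).inter (measurableSet_lt measurable_const hm)
  · simp only [dyadicAnnulus, hk, false_imp_iff, and_true]
    exact measurableSet_le hm measurable_const

/-- The annulus fills at least half of the enclosing arc, so passing from one to the other costs a
factor 2. -/
theorem ofReal_dyadicRadius_le_volume_dyadicAnnulus (x : UnitCirc) (N k : ℕ) :
    ENNReal.ofReal (dyadicRadius k) ≤ volume (dyadicAnnulus x N k) := by
  have hsub : Metric.closedBall x (dyadicRadius k) \ Metric.closedBall x (dyadicRadius (k + 1)) ⊆
      dyadicAnnulus x N k := fun t ht => by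
    rw [mem_sdiff, mem_closedBall_iff_norm, mem_closedBall_iff_norm, not_le] at ht
    exact ⟨ht.1, fun _ => ht.2⟩
  refine le_trans ?_ ((le_measure_sdiff).trans (measure_mono hsub))
  rw [volume_closedBall_dyadicRadius, volume_closedBall_dyadicRadius, ← ENNReal.ofReal_sub _
    (by linarith [dyadicRadius_pos (k + 1)]), dyadicRadius_succ]
  exact ENNReal.ofReal_le_ofReal (by linarith)

theorem iUnion_dyadicAnnulus (x : UnitCirc) (N : ℕ) :
    ⋃ k ∈ Finset.range (N + 1), dyadicAnnulus x N k = univ := by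
  rw [eq_univ_iff_forall]
  intro t
  classical
  -- The annulus containing `t` is that of the greatest `n ≤ N` whose radius still reaches `t`.
  by_cases h : ∃ n, n ≤ N ∧ ‖t - x‖ ≤ dyadicRadius n ∧ ∀ m, m ≤ N → ‖t - x‖ ≤ dyadicRadius m → m ≤ n
  · obtain ⟨n, hn, h1, h2⟩ := h
    refine mem_biUnion (x := n) (by simp; omega) ⟨h1, fun hlt => ?_⟩
    by_contra! hc
    have := h2 (n + 1) hlt hc
    omega
  · exfalso
    let S := (Finset.range (N + 1)).filter fun n => ‖t - x‖ ≤ dyadicRadius n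
    have hS : S.Nonempty := ⟨0, by simp [S, dyadicRadius_zero, UnitCirc.norm_le_pi]⟩
    obtain ⟨h1, h2⟩ := Finset.mem_filter.mp (S.max'_mem hS)
    exact h ⟨S.max' hS, Nat.lt_succ_iff.mp (Finset.mem_range.mp h1), h2,
      fun m hm hm' => S.le_max' _ (by simp [S, hm']; omega)⟩

theorem pairwiseDisjoint_dyadicAnnulus (x : UnitCirc) (N : ℕ) :
    (↑(Finset.range (N + 1)) : Set ℕ).PairwiseDisjoint (dyadicAnnulus x N) := by
  have key : ∀ j k, j < k → k ≤ N → Disjoint (dyadicAnnulus x N j) (dyadicAnnulus x N k) := by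
    intro j k hjk hk
    rw [Set.disjoint_left]
    rintro t ⟨-, h1⟩ ⟨h2, -⟩
    exact absurd ((h1 (by omega)).trans_le (h2.trans (dyadicRadius_anti hjk))) (lt_irrefl _)
  intro j hj k hk hne
  simp only [Finset.coe_range, mem_Iio] at hj hk
  rcases lt_or_gt_of_ne hne with h | h
  · exact key j k h (by omega)
  · exact (key k j h (by omega)).symm

/-- The numerator `1 - ‖w‖²` does not depend on the boundary point, so only the squared distances
compete. -/
theorem poissonKernel_le_mul_of_norm_le {w : ℂ} (hw : ‖w‖ < 1) {s t : UnitCirc} {c : ℝ}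
    (h : ‖polarPt 1 t - w‖ ≤ c * ‖polarPt 1 s - w‖) :
    poissonKernel 0 w (polarPt 1 s) ≤ c ^ 2 * poissonKernel 0 w (polarPt 1 t) := by
  have h1 := norm_pos_iff.mpr (polarPt_sub_ne_zero hw s)
  have h2 := norm_pos_iff.mpr (polarPt_sub_ne_zero hw t)
  have h3 : 0 ≤ 1 - ‖w‖ ^ 2 := by
    have : ‖w‖ ^ 2 ≤ 1 := pow_le_one₀ (norm_nonneg _) hw.le
    linarith
  rw [poissonKernel_polarPt, poissonKernel_polarPt, ← mul_div_assoc,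
    div_le_div_iff₀ (by positivity) (by positivity), mul_assoc, mul_left_comm]
  gcongr
  rw [← mul_pow]
  gcongr

/-- The Poisson kernel at a point of the approach region is essentially constant on suitable
dyadic annuli. -/
theorem exists_poissonKernel_le_mul_on_dyadicAnnulus {x : UnitCirc} {w : ℂ}
    (hw : w ∈ approachRegion x) :
    ∃ N : ℕ, ∀ k ≤ N, ∀ s ∈ dyadicAnnulus x N k, ∀ t ∈ dyadicAnnulus x N k,
      poissonKernel 0 w (polarPt 1 s) ≤ 14 ^ 2 * poissonKernel 0 w (polarPt 1 t) := by
  have hw1 := norm_lt_one_of_mem_approachRegion hw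
  obtain ⟨N, hN, hN'⟩ := exists_dyadicRadius_mem_Ioc (h := 1 - ‖w‖) (by linarith)
    (by linarith [Real.pi_gt_three, norm_nonneg w])
  refine ⟨N, fun k hk s hs t ht => poissonKernel_le_mul_of_norm_le hw1 ?_⟩
  -- With `d = |e^{is} - w| ≥ 1 - ‖w‖`: for `k < N` the radius is below `2‖s - x‖ ≤ 8d`, so `|e^{it}
  -- - w| ≤ (8 + 3/2) d`; for `k = N` the radius is below `2(1 - ‖w‖)`, which gives `(2 + 3/2) d`.
  -- Both factors are below 14.
  have e1 := norm_polarPt_one_sub_le_of_mem_approachRegion hw t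
  have e2 := norm_sub_le_of_mem_approachRegion hw s
  have e3 := one_sub_norm_le s w
  rcases hk.lt_or_eq with h | rfl
  · have := hs.2 h
    have h2 := dyadicRadius_anti h
    rw [Nat.succ_eq_add_one] at h2
    rw [dyadicRadius_succ] at this h2
    linarith [ht.1]
  · linarith [ht.1]

/-! ### Dyadic maximal function, Jensen's inequality and the pointwise bound -/

/-- The centred maximal function over arcs of radius `π 2^{-k}`. -/
def dyadicMax (g : UnitCirc → ℝ≥0∞) (x : UnitCirc) : ℝ≥0∞ :=
  ⨆ k : ℕ, (volume (Metric.closedBall x (dyadicRadius k)))⁻¹ *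
    ∫⁻ y in Metric.closedBall x (dyadicRadius k), g y

theorem dyadicMax_le_hlMax (g : UnitCirc → ℝ≥0∞) (x : UnitCirc) : dyadicMax g x ≤ hlMax g x :=
  iSup_le fun k => le_iSup₂_of_le (Metric.closedBall x (dyadicRadius k))
    ⟨isArc_closedBall_dyadicRadius x k, Metric.mem_closedBall_self (dyadicRadius_pos k).le⟩ le_rfl

/-- Restricting to countably many radii makes measurability, which Fatou's lemma needs later, a
matter of Tonelli's theorem. -/
theorem measurable_dyadicMax {g : UnitCirc → ℝ≥0∞} (hg : Measurable g) :
    Measurable (dyadicMax g) := by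
  refine Measurable.iSup fun k => ?_
  simp only [volume_closedBall_dyadicRadius]
  refine Measurable.const_mul ?_ _
  have h : ∀ x : UnitCirc, ∫⁻ y in Metric.closedBall x (dyadicRadius k), g y =
      ∫⁻ y, {p : UnitCirc × UnitCirc | dist p.2 p.1 ≤ dyadicRadius k}.indicator
        (fun p => g p.2) (x, y) := fun x => by
    rw [← lintegral_indicator measurableSet_closedBall]
    rfl
  simp only [h]
  refine Measurable.lintegral_prod_right' (f := {p : UnitCirc × UnitCirc |
    dist p.2 p.1 ≤ dyadicRadius k}.indicator (fun p => g p.2)) ?_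
  exact (hg.comp measurable_snd).indicator
    (measurableSet_le (measurable_snd.dist measurable_fst) measurable_const)

theorem dyadicMax_congr_ae {g g' : UnitCirc → ℝ≥0∞} (h : g =ᵐ[volume] g') :
    dyadicMax g = dyadicMax g' := by
  ext x
  simp only [dyadicMax, lintegral_congr_ae (ae_restrict_of_ae h)]

/-- Moves `φ` to the real line, where Jensen's inequality and continuity of convex functions are
available. Monotonicity enters because `Real.toNNReal` is only subadditive. -/
theorem ConvexOn.comp_toNNReal {φ : ℝ≥0 → ℝ≥0} (hφ : ConvexOn ℝ≥0 univ φ) (hm : Monotone φ) :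
    ConvexOn ℝ univ fun s : ℝ => (φ s.toNNReal : ℝ) := by
  refine ⟨convex_univ, fun s _ t _ a b ha hb hab => ?_⟩
  lift a to ℝ≥0 using ha
  lift b to ℝ≥0 using hb
  have h1 : (a • s + b • t).toNNReal ≤ a • s.toNNReal + b • t.toNNReal := by
    refine Real.toNNReal_add_le.trans (add_le_add ?_ ?_) <;>
      simp [NNReal.smul_def, Real.toNNReal_mul]
  have h2 := (hm h1).trans (hφ.2 (mem_univ _) (mem_univ _) a.2 b.2 (by exact_mod_cast hab))
  exact_mod_cast h2

/-- Averages for `K dμ` and for `dμ` over `A` differ by at most the oscillation `c` of `K`, written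
without division. Integrating `K s ≤ c K t` over `t` in `A` bounds `K s` by `c` times its mean. -/
theorem lintegral_withDensity_mul_le {α : Type*} [MeasurableSpace α] {μ : Measure α}
    {K v : α → ℝ≥0∞} (hK : Measurable K) (hv : Measurable v) {A : Set α} (hA : MeasurableSet A)
    {c : ℝ≥0∞} (h : ∀ s ∈ A, ∀ t ∈ A, K s ≤ c * K t) :
    μ A * ∫⁻ t in A, v t ∂μ.withDensity K ≤
      c * μ.withDensity K A * ∫⁻ t in A, v t ∂μ := by
  have h1 : ∀ s ∈ A, μ A * K s ≤ c * μ.withDensity K A := fun s hs => by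
    rw [withDensity_apply _ hA, ← lintegral_const_mul _ hK, mul_comm, ← setLIntegral_const]
    exact setLIntegral_mono (hK.const_mul c) fun t ht => h s hs t ht
  rw [restrict_withDensity hA, lintegral_withDensity_eq_lintegral_mul _ hK hv,
    ← lintegral_const_mul _ (hK.mul hv), ← lintegral_const_mul _ hv]
  refine setLIntegral_mono (hv.const_mul _) fun t ht => ?_
  rw [Pi.mul_apply, ← mul_assoc]
  exact mul_le_mul_left (h1 t ht) _

theorem poissonMeasure_ne_zero {w : ℂ} (hw : ‖w‖ < 1) {A : Set UnitCirc}
    (h : volume A ≠ 0) : poissonMeasure w A ≠ 0 := by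
  rw [poissonMeasure, Ne, withDensity_apply_eq_zero
    ((continuous_poissonKernel_polarPt hw).const_mul _).measurable.ennreal_ofReal]
  rw [inter_eq_right.mpr]
  · exact h
  intro t _
  have h1 := norm_pos_iff.mpr (polarPt_sub_ne_zero hw t)
  have h3 : 0 < 1 - ‖w‖ ^ 2 := by
    have : ‖w‖ ^ 2 < 1 := pow_lt_one₀ (norm_nonneg _) hw two_ne_zero
    linarith
  simp only [mem_ofPred_eq, ne_eq, ENNReal.ofReal_eq_zero, not_le, poissonKernel_polarPt]
  positivity

/-- A number below the Poisson integral of `u` at a point of the approach region at `x` is below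
the average of `u` over some dyadic annulus around `x`, on which the Poisson kernel is essentially
constant. -/
theorem exists_dyadicAnnulus_mul_le_setIntegral {x : UnitCirc} {w : ℂ} (hw : w ∈ approachRegion x)
    {u : UnitCirc → ℝ} (hu : Integrable u (poissonMeasure w)) {y : ℝ}
    (hy : y ≤ ∫ t, u t ∂poissonMeasure w) :
    ∃ N k : ℕ, y * (poissonMeasure w).real (dyadicAnnulus x N k) ≤
        ∫ t in dyadicAnnulus x N k, u t ∂poissonMeasure w ∧
      ∀ s ∈ dyadicAnnulus x N k, ∀ t ∈ dyadicAnnulus x N k,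
        poissonKernel 0 w (polarPt 1 s) ≤ 14 ^ 2 * poissonKernel 0 w (polarPt 1 t) := by
  have := isProbabilityMeasure_poissonMeasure (norm_lt_one_of_mem_approachRegion hw)
  obtain ⟨N, hN⟩ := exists_poissonKernel_le_mul_on_dyadicAnnulus hw
  have h1 : ∑ k ∈ Finset.range (N + 1), (poissonMeasure w).real (dyadicAnnulus x N k) = 1 := by
    rw [← measureReal_biUnion_finset (pairwiseDisjoint_dyadicAnnulus x N)
      (fun k _ => measurableSet_dyadicAnnulus x N k), iUnion_dyadicAnnulus, probReal_univ]
  have h2 : ∑ k ∈ Finset.range (N + 1), ∫ t in dyadicAnnulus x N k, u t ∂poissonMeasure w =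
      ∫ t, u t ∂poissonMeasure w := by
    rw [← integral_biUnion_finset _ (fun k _ => measurableSet_dyadicAnnulus x N k)
      (pairwiseDisjoint_dyadicAnnulus x N) (fun k _ => hu.integrableOn), iUnion_dyadicAnnulus,
      Measure.restrict_univ]
  have h3 : ∑ k ∈ Finset.range (N + 1), y * (poissonMeasure w).real (dyadicAnnulus x N k) ≤
      ∑ k ∈ Finset.range (N + 1), ∫ t in dyadicAnnulus x N k, u t ∂poissonMeasure w := by
    rwa [← Finset.mul_sum, h1, h2, mul_one]
  -- Pigeonhole: the Poisson masses of the annuli sum to 1, so the inequality summed over `k` holds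
  -- for some single `k`.
  obtain ⟨k, hk, h⟩ := Finset.exists_le_of_sum_le ⟨0, by simp⟩ h3
  exact ⟨N, k, h, hN k (by simpa [Nat.lt_succ_iff] using hk)⟩

/-- Jensen's inequality for the normalised Poisson measure on `A`, then a change to arc length at
the cost of the kernel's oscillation `14²`. -/
theorem lower_mul_volume_le_lintegral {φ : ℝ≥0 → ℝ≥0} (hφ : ConvexOn ℝ≥0 univ φ)
    (hm : Monotone φ) {u : UnitCirc → ℝ≥0} (hu : Continuous u) {w : ℂ} (hw : ‖w‖ < 1)
    {A : Set UnitCirc} (hA : MeasurableSet A) (hA0 : volume A ≠ 0)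
    (hK : ∀ s ∈ A, ∀ t ∈ A,
      poissonKernel 0 w (polarPt 1 s) ≤ 14 ^ 2 * poissonKernel 0 w (polarPt 1 t))
    {y : ℝ≥0} (hy : y * (poissonMeasure w).real A ≤ ∫ t in A, (u t : ℝ) ∂poissonMeasure w) :
    volume A * φ y ≤ 14 ^ 2 * ∫⁻ t in A, φ (u t) := by
  have := isProbabilityMeasure_poissonMeasure hw
  set ν := poissonMeasure w with hν
  have hνA : ν A ≠ 0 := poissonMeasure_ne_zero hw hA0
  have hνA' : 0 < ν.real A := (measureReal_nonneg).lt_of_ne' (by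
    rw [Ne, measureReal_eq_zero_iff]; exact hνA)
  have hc := hφ.comp_toNNReal hm
  have hcont : Continuous fun s : ℝ => (φ s.toNNReal : ℝ) :=
    continuousOn_univ.mp (hc.continuousOn isOpen_univ)
  have hint : ∀ v : UnitCirc → ℝ, Continuous v → Integrable v ν := fun v hv => by
    obtain ⟨C, hC⟩ := isCompact_univ.exists_bound_of_continuousOn hv.continuousOn
    exact Integrable.of_bound hv.aestronglyMeasurable C (.of_forall fun t => hC t trivial)
  have hur : Continuous fun t => (u t : ℝ) := NNReal.continuous_coe.comp hu
  have hφu : Continuous fun t => (φ (u t) : ℝ) := by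
    simpa [Function.comp_def] using hcont.comp hur
  have hJ := hc.map_set_average_le hcont.continuousOn isClosed_univ hνA (measure_ne_top _ _)
    (f := fun t => (u t : ℝ)) (.of_forall fun _ => mem_univ _) (hint _ hur).integrableOn
    (hint _ (hcont.comp hur)).integrableOn
  simp only [Real.toNNReal_coe] at hJ
  have hy' : y ≤ (⨍ t in A, (u t : ℝ) ∂ν).toNNReal := by
    rw [← NNReal.coe_le_coe, setAverage_eq, smul_eq_mul]
    refine le_trans ?_ (Real.le_coe_toNNReal _)
    rwa [inv_mul_eq_div, le_div_iff₀ hνA']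
  have h1 : (φ y : ℝ) * ν.real A ≤ ∫ t in A, (φ (u t) : ℝ) ∂ν := by
    rw [← le_div_iff₀ hνA', ← inv_mul_eq_div, ← smul_eq_mul, ← setAverage_eq]
    exact (NNReal.coe_le_coe.mpr (hm hy')).trans hJ
  have h2 : (φ y : ℝ≥0∞) * ν A ≤ ∫⁻ t in A, φ (u t) ∂ν := by
    have h3 := ENNReal.ofReal_le_ofReal h1
    rw [ofReal_integral_eq_lintegral_ofReal (hint _ hφu).integrableOn
      (.of_forall fun t => NNReal.coe_nonneg _), ENNReal.ofReal_mul (NNReal.coe_nonneg _),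
      ofReal_measureReal] at h3
    simpa using h3
  have hφm : Measurable fun t => (φ (u t) : ℝ≥0∞) := by
    simpa using hφu.measurable.ennreal_ofReal
  have h4 := lintegral_withDensity_mul_le (μ := volume)
    ((continuous_poissonKernel_polarPt hw).const_mul (2 * Real.pi)⁻¹).measurable.ennreal_ofReal
    hφm hA (c := 14 ^ 2) (fun s hs t ht => by
      have : (14 ^ 2 : ℝ≥0∞) = ENNReal.ofReal (14 ^ 2) := by
        rw [ENNReal.ofReal_pow (by norm_num)]; norm_num
      rw [this, ← ENNReal.ofReal_mul (by positivity)]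
      refine ENNReal.ofReal_le_ofReal ?_
      rw [mul_left_comm]
      exact mul_le_mul_of_nonneg_left (hK s hs t ht) (by positivity))
  change volume A * ∫⁻ t in A, φ (u t) ∂ν ≤ 14 ^ 2 * ν A * _ at h4
  rw [← ENNReal.mul_le_mul_iff_right hνA (measure_ne_top _ _)]
  calc ν A * (volume A * φ y) = volume A * (φ y * ν A) := by ring
    _ ≤ volume A * ∫⁻ t in A, φ (u t) ∂ν := by gcongr
    _ ≤ _ := h4
    _ = _ := by ring

/-- One arc `I` serves the whole estimate: `Φ_{I,-}` is used under the integral, `Φ_{I,+}` at `x`,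
and slow change joins them. -/
theorem ModularFamily.exists_fn_le_mul_dyadicMax {Φ : ModularFamily} (hs : Φ.SlowlyChanging)
    (hc : Φ.IsConvex) (D : ℝ≥0) :
    ∃ C : ℝ≥0, ∀ u : UnitCirc → ℝ≥0, Continuous u → ∫⁻ t, Φ.fn t (u t) ≤ D →
      ∀ x, ∀ w ∈ approachRegion x, ∀ y : ℝ≥0, (y : ℝ) ≤ ∫ t, (u t : ℝ) ∂poissonMeasure w →
        (Φ.fn x y : ℝ≥0∞) ≤ C * dyadicMax (fun t => Φ.fn t (u t)) x := by
  -- `392 = 2 · 14²`: the 2 from annulus against arc, `14²` from the kernel. The `+ 1` keeps the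
  -- parameter positive when `D = 0`.
  obtain ⟨C, -, hC⟩ := hs (392 * D + 1) (by positivity)
  refine ⟨C * 392, fun u hu hD x w hw y hy => ?_⟩
  have hw1 := norm_lt_one_of_mem_approachRegion hw
  have := isProbabilityMeasure_poissonMeasure hw1
  have hur : Continuous fun t => (u t : ℝ) := NNReal.continuous_coe.comp hu
  have hint : Integrable (fun t => (u t : ℝ)) (poissonMeasure w) := by
    obtain ⟨M, hM⟩ := isCompact_univ.exists_bound_of_continuousOn hur.continuousOn
    exact Integrable.of_bound hur.aestronglyMeasurable M (.of_forall fun t => hM t trivial)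
  obtain ⟨N, k, hk, hK⟩ := exists_dyadicAnnulus_mul_le_setIntegral hw hint hy
  set A := dyadicAnnulus x N k with hAdef
  set I := Metric.closedBall x (dyadicRadius k) with hI
  have hIarc : IsArc I := isArc_closedBall_dyadicRadius x k
  have hxI : x ∈ I := Metric.mem_closedBall_self (dyadicRadius_pos k).le
  have hvolI : volume I = 2 * ENNReal.ofReal (dyadicRadius k) := by
    rw [volume_closedBall_dyadicRadius, ENNReal.ofReal_mul (by norm_num)]; norm_num
  have hvolA := ofReal_dyadicRadius_le_volume_dyadicAnnulus x N k
  have hδ : ENNReal.ofReal (dyadicRadius k) ≠ 0 := by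
    simpa using dyadicRadius_pos k
  have hI0 : volume I ≠ 0 := by rw [hvolI]; exact mul_ne_zero two_ne_zero hδ
  have h1 := lower_mul_volume_le_lintegral
    (hc (Φ.lower I) (Or.inr ⟨I, hIarc, Or.inr rfl⟩)) (Φ.lower_mono I hIarc) hu hw1
    (measurableSet_dyadicAnnulus x N k) (ne_bot_of_le_ne_bot hδ hvolA) hK hk
  have h2 : ∫⁻ t in A, (Φ.lower I (u t) : ℝ≥0∞) ≤ ∫⁻ t in I, Φ.fn t (u t) := by
    refine (lintegral_mono_set (dyadicAnnulus_subset x N k)).trans ?_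
    refine setLIntegral_mono' Metric.isClosed_closedBall.measurableSet fun t ht => ?_
    exact ENNReal.coe_le_coe.mpr (Φ.lower_le_fn I hIarc t (subset_closure ht) _)
  have h3 : volume I * Φ.lower I y ≤ 392 * ∫⁻ t in I, Φ.fn t (u t) := by
    calc volume I * Φ.lower I y ≤ 2 * volume A * Φ.lower I y := by rw [hvolI]; gcongr
      _ = 2 * (volume A * Φ.lower I y) := by ring
      _ ≤ 2 * (14 ^ 2 * ∫⁻ t in I, Φ.fn t (u t)) := 
          mul_le_mul_right (h1.trans (mul_le_mul_right h2 _)) _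
      _ = _ := by rw [← mul_assoc]; norm_num
  -- The integral bound `D` brings `y` into the range where slow change applies.
  have h4 : (Φ.lower I y : ℝ≥0∞) ≤ ((392 * D + 1 : ℝ≥0) : ℝ≥0∞) / volume I := by
    rw [ENNReal.le_div_iff_mul_le (Or.inl hI0) (Or.inl (measure_ne_top _ _)), mul_comm]
    refine h3.trans ?_
    push_cast
    refine le_trans ?_ le_self_add
    gcongr
    exact (setLIntegral_le_lintegral _ _).trans hD
  calc (Φ.fn x y : ℝ≥0∞) ≤ (C * Φ.lower I y : ℝ≥0) :=
        ENNReal.coe_le_coe.mpr ((Φ.fn_le_upper I hIarc x (subset_closure hxI) y).trans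
          (hC I hIarc y h4))
    _ = C * Φ.lower I y := by push_cast; rfl
    _ ≤ C * (392 * ((volume I)⁻¹ * ∫⁻ t in I, Φ.fn t (u t))) := by
        gcongr
        rw [mul_left_comm, ← ENNReal.div_eq_inv_mul, ENNReal.le_div_iff_mul_le (Or.inl hI0)
          (Or.inl (measure_ne_top _ _)), mul_comm]
        exact h3
    _ ≤ C * (392 * dyadicMax (fun t => Φ.fn t (u t)) x) := by
        gcongr
        exact le_iSup (fun k : ℕ => (volume (Metric.closedBall x (dyadicRadius k)))⁻¹ *
          ∫⁻ y in Metric.closedBall x (dyadicRadius k), (Φ.fn y (u y) : ℝ≥0∞)) k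
    _ = _ := by push_cast; ring

/-! ### Extended values, Fatou's lemma and the passage to the boundary -/

open Filter Topology

namespace ModularFamily

variable {Φ Ψ : ModularFamily}

theorem eval_mono (Φ : ModularFamily) (x : UnitCirc) : Monotone (Φ.eval x) := fun _ _ h =>
  iSup₂_le fun s hs => le_iSup₂_of_le s (hs.trans h) le_rfl

/-- Truncation at integers gives a countable supremum of finite-valued compositions, whence
measurability. -/
theorem eval_eq_iSup_nat (Φ : ModularFamily) (x : UnitCirc) (y : ℝ≥0∞) :
    Φ.eval x y = ⨆ n : ℕ, (Φ.fn x (min y n).toNNReal : ℝ≥0∞) := by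
  apply le_antisymm
  · refine iSup₂_le fun s hs => ?_
    obtain ⟨n, hn⟩ := exists_nat_ge s
    refine le_iSup_of_le n (ENNReal.coe_le_coe.mpr (Φ.fn_mono x ?_))
    rw [← ENNReal.coe_le_coe, ENNReal.coe_toNNReal
      (ne_top_of_le_ne_top (ENNReal.natCast_ne_top n) (min_le_right _ _))]
    exact le_min hs (by exact_mod_cast hn)
  · refine iSup_le fun n => le_iSup₂_of_le (min y n).toNNReal ?_ le_rfl
    exact ENNReal.coe_toNNReal_le_self.trans (min_le_left _ _)

theorem aemeasurable_eval (Φ : ModularFamily) {h : UnitCirc → ℝ≥0∞} (hh : Measurable h) :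
    AEMeasurable (fun x => Φ.eval x (h x)) volume := by
  simp only [eval_eq_iSup_nat]
  exact AEMeasurable.iSup fun n =>
    (Φ.aemeasurable_fn _ (hh.min measurable_const).ennreal_toNNReal).coe_nnreal_ennreal

theorem eval_le_iSup_fn_nat (Φ : ModularFamily) (x : UnitCirc) (y : ℝ≥0∞) :
    Φ.eval x y ≤ ⨆ n : ℕ, (Φ.fn x n : ℝ≥0∞) :=
  iSup₂_le fun s _ => by
    obtain ⟨n, hn⟩ := exists_nat_ge s
    exact le_iSup_of_le n (ENNReal.coe_le_coe.mpr (Φ.fn_mono x hn))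

/-- Every `s'` below the supremum is exceeded by some `a i`; continuity is needed only to reach the
supremum itself. -/
theorem eval_iSup_le {ι : Type*} [Nonempty ι] (Φ : ModularFamily) {x : UnitCirc}
    (hc : Continuous (Φ.fn x)) (a : ι → ℝ≥0) :
    Φ.eval x (⨆ i, (a i : ℝ≥0∞)) ≤ ⨆ i, (Φ.fn x (a i) : ℝ≥0∞) := by
  refine iSup₂_le fun s hs => ?_
  have hlt : ∀ s' < s, (Φ.fn x s' : ℝ≥0∞) ≤ ⨆ i, (Φ.fn x (a i) : ℝ≥0∞) := fun s' h => by
    obtain ⟨i, hi⟩ := lt_iSup_iff.mp ((ENNReal.coe_lt_coe.mpr h).trans_le hs)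
    exact le_iSup_of_le i
      (ENNReal.coe_le_coe.mpr (Φ.fn_mono x (ENNReal.coe_lt_coe.mp hi).le))
  rcases eq_or_ne s 0 with rfl | h0
  · exact le_iSup_of_le (Classical.arbitrary ι)
      (ENNReal.coe_le_coe.mpr (Φ.fn_mono x zero_le))
  · have : (𝓝[<] s).NeBot := nhdsLT_neBot_of_exists_lt ⟨0, pos_iff_ne_zero.mpr h0⟩
    have ht : Tendsto (fun s' => (Φ.fn x s' : ℝ≥0∞)) (𝓝[<] s) (𝓝 (Φ.fn x s : ℝ≥0∞)) :=
      (ENNReal.continuous_coe.comp hc).continuousAt.continuousWithinAt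
    exact le_of_tendsto ht (eventually_nhdsWithin_of_forall hlt)

theorem IsConvex.continuous_fn (hΦ : Φ.IsConvex) (x : UnitCirc) : Continuous (Φ.fn x) := by
  have h := (hΦ (Φ.fn x) (Or.inl ⟨x, rfl⟩)).comp_toNNReal (Φ.fn_mono x)
  have hc : Continuous fun s : ℝ => (Φ.fn x s.toNNReal : ℝ) :=
    continuousOn_univ.mp (h.continuousOn isOpen_univ)
  have := hc.comp NNReal.continuous_coe
  simp only [Function.comp_def, Real.toNNReal_coe] at this
  exact NNReal.isEmbedding_coe.continuous_iff.mpr this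

theorem continuous_logPlus_fn (x : UnitCirc) : Continuous (logPlus.fn x) :=
  continuous_real_toNNReal.comp (Real.continuous_posLog.comp NNReal.continuous_coe)

theorem UniformlyDoubling.exists_pow (h : Ψ.UniformlyDoubling) (m : ℕ) :
    ∃ K : ℝ≥0, 1 ≤ K ∧ ∀ x t, Ψ.fn x (2 ^ m * t) ≤ K * Ψ.fn x t := by
  obtain ⟨C, hC⟩ := h
  refine ⟨max C 1 ^ m, one_le_pow₀ (le_max_right _ _), fun x t => ?_⟩
  induction m with
  | zero => simp
  | succ m ih =>
    calc Ψ.fn x (2 ^ (m + 1) * t) = Ψ.fn x (2 * (2 ^ m * t)) := by rw [pow_succ']; ring_nf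
      _ ≤ C * Ψ.fn x (2 ^ m * t) := hC _ (Or.inl ⟨x, rfl⟩) _
      _ ≤ max C 1 * (max C 1 ^ m * Ψ.fn x t) := by gcongr; exact le_max_left _ _
      _ = _ := by rw [pow_succ']; ring

/-- A doubling family has the Fatou property, up to a constant. -/
theorem UniformlyDoubling.exists_eval_liminf_le (h : Ψ.UniformlyDoubling) (C : ℝ≥0) :
    ∃ K : ℝ≥0, ∀ x (G : ℕ → ℝ≥0∞), Ψ.eval x (liminf (fun n => C * G n) atTop) ≤
      K * liminf (fun n => Ψ.eval x (G n)) atTop := by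
  -- If `C G > s / 2` then `G ≥ s / 2^m`, and `m` doublings return to `s`. Halving `s` gives the
  -- strict inequality below the liminf, so no continuity of `Ψ_x` is needed.
  obtain ⟨m, hm⟩ := pow_unbounded_of_one_lt (2 * C) (one_lt_two (α := ℝ≥0))
  obtain ⟨K, hK1, hK⟩ := h.exists_pow m
  refine ⟨K, fun x G => iSup₂_le fun s hs => ?_⟩
  rw [← ENNReal.liminf_const_mul_of_ne_top ENNReal.coe_ne_top]
  refine le_liminf_of_le (by isBoundedDefault) ?_
  rcases eq_or_ne s 0 with rfl | h0
  · refine .of_forall fun n => ?_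
    calc (Ψ.fn x 0 : ℝ≥0∞) = 1 * Ψ.eval x 0 := by rw [one_mul, ← ENNReal.coe_zero, eval_coe]
      _ ≤ K * Ψ.eval x (G n) :=
        mul_le_mul' (by exact_mod_cast hK1) (Ψ.eval_mono x zero_le)
  · have hlt : ((s / 2 : ℝ≥0) : ℝ≥0∞) < liminf (fun n => C * G n) atTop :=
      (ENNReal.coe_lt_coe.mpr (NNReal.half_lt_self h0)).trans_le hs
    filter_upwards [eventually_lt_of_lt_liminf hlt] with n hn
    have h1 : ((s / 2 ^ m : ℝ≥0) : ℝ≥0∞) ≤ G n := by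
      by_contra! hc
      refine absurd hn (not_lt.mpr ?_)
      calc C * G n ≤ ((C * (s / 2 ^ m) : ℝ≥0) : ℝ≥0∞) := by
            rw [ENNReal.coe_mul]; gcongr
        _ ≤ ((s / 2 : ℝ≥0) : ℝ≥0∞) := by
          refine ENNReal.coe_le_coe.mpr ?_
          rw [← mul_div_assoc, div_le_div_iff₀ (by positivity) (by positivity)]
          calc C * s * 2 = s * (2 * C) := by ring
            _ ≤ s * 2 ^ m := by gcongr
    calc (Ψ.fn x s : ℝ≥0∞) = Ψ.fn x (2 ^ m * (s / 2 ^ m)) := by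
          rw [mul_div_cancel₀ _ (by positivity)]
      _ ≤ (K * Ψ.fn x (s / 2 ^ m) : ℝ≥0) := ENNReal.coe_le_coe.mpr (hK x _)
      _ = K * Ψ.eval x ((s / 2 ^ m : ℝ≥0) : ℝ≥0∞) := by rw [eval_coe]; push_cast; rfl
      _ ≤ K * Ψ.eval x (G n) := by gcongr; exact Ψ.eval_mono x h1

theorem modular_congr_ae {g g' : UnitCirc → ℝ≥0∞} (h : g =ᵐ[volume] g') :
    Ψ.modular g = Ψ.modular g' :=
  lintegral_congr_ae (h.mono fun x hx => by simp only [hx])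

theorem _root_.hlMax_congr_ae {g g' : UnitCirc → ℝ≥0∞} (h : g =ᵐ[volume] g') :
    hlMax g = hlMax g' := by
  ext x
  simp only [hlMax, lintegral_congr_ae (ae_restrict_of_ae h)]

/-- The functions `Φ_t(u(t))` are known to be measurable only up to null sets. -/
theorem _root_.HLBounded.exists_of_aemeasurable (h : HLBounded Ψ) {A : ℝ≥0} (hA : 0 < A) :
    ∃ B : ℝ≥0, 0 < B ∧ ∀ g : UnitCirc → ℝ≥0, AEMeasurable g volume →
      Ψ.modular (fun x => (g x : ℝ≥0∞)) ≤ A →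
      Ψ.modular (hlMax fun x => (g x : ℝ≥0∞)) ≤ B := by
  obtain ⟨B, hB0, hB⟩ := h A hA
  refine ⟨B, hB0, fun g hg hgA => ?_⟩
  have hae : (fun x => (g x : ℝ≥0∞)) =ᵐ[volume] fun x => ((hg.mk g x : ℝ≥0) : ℝ≥0∞) :=
    hg.ae_eq_mk.mono fun x hx => by simp only [hx]
  rw [hlMax_congr_ae hae]
  exact hB _ hg.measurable_mk (modular_congr_ae hae ▸ hgA)

theorem _root_.UnitCirc.isArc_univ : IsArc (univ : Set UnitCirc) := by
  refine ⟨0, 0 + 2 * Real.pi, by positivity, le_rfl, subset_univ _, ?_⟩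
  exact (AddCircle.coe_image_Icc_eq (2 * Real.pi) 0).symm.subset

/-- If the maximal operator is bounded, then either the modular controls the integral, or the
whole modular is bounded. -/
theorem exists_lintegral_le_or_forall_modular_le {A B : ℝ≥0}
    (hB : ∀ g : UnitCirc → ℝ≥0, AEMeasurable g volume →
      Ψ.modular (fun x => (g x : ℝ≥0∞)) ≤ A → Ψ.modular (hlMax fun x => (g x : ℝ≥0∞)) ≤ B) :
    (∃ D : ℝ≥0, ∀ g : UnitCirc → ℝ≥0, AEMeasurable g volume →
      Ψ.modular (fun x => (g x : ℝ≥0∞)) ≤ A → ∫⁻ x, g x ≤ D) ∨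
    ∀ g : UnitCirc → ℝ≥0∞, Ψ.modular g ≤ B := by
  refine or_iff_not_imp_left.mpr fun hD g => ?_
  push Not at hD
  have hconst : ∀ n : ℕ, ∫⁻ x, Ψ.fn x n ≤ (B : ℝ≥0∞) := fun n => by
    -- An integral above `2πn` makes the mean over the whole circle, hence the maximal function
    -- everywhere, at least `n`.
    obtain ⟨g, hg, hgA, hlt⟩ := hD ((2 * Real.pi).toNNReal * n)
    refine le_trans (lintegral_mono fun x => ?_) (hB g hg hgA)
    rw [← eval_coe]
    refine Ψ.eval_mono x (le_iSup₂_of_le univ ⟨UnitCirc.isArc_univ, trivial⟩ ?_)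
    rw [Measure.restrict_univ, AddCircle.measure_univ, ← ENNReal.div_eq_inv_mul,
      ENNReal.le_div_iff_mul_le (by simp [Real.pi_pos])
      (Or.inl ENNReal.ofReal_ne_top), mul_comm]
    exact_mod_cast hlt.le
  calc Ψ.modular g ≤ ∫⁻ x, ⨆ n : ℕ, (Ψ.fn x n : ℝ≥0∞) :=
        lintegral_mono fun x => Ψ.eval_le_iSup_fn_nat x _
    _ = ⨆ n : ℕ, ∫⁻ x, (Ψ.fn x n : ℝ≥0∞) :=
        lintegral_iSup' (fun n => (Ψ.aemeasurable_fn _ measurable_const).coe_nnreal_ennreal)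
          (.of_forall fun x m n h => ENNReal.coe_le_coe.mpr (Ψ.fn_mono x (by exact_mod_cast h)))
    _ ≤ B := iSup_le hconst

/-- Pointwise bound for the nontangential maximal function by the maximal functions of the
boundary values on the circles of radii `r n`. -/
theorem eval_logPlus_ntMax_le_liminf (hΦ : Φ.IsConvex) {C : ℝ≥0} {f : ℂ → ℂ}
    (hf : AnalyticOnNhd ℂ f (Metric.ball 0 1)) {r : ℕ → ℝ} (hr : ∀ n, r n ∈ Ioo (0 : ℝ) 1)
    (hr1 : Tendsto r atTop (𝓝 1)) {x : UnitCirc} {G : ℕ → ℝ≥0∞}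
    (hG : ∀ n, ∀ w ∈ approachRegion x, ∀ y : ℝ≥0,
      (y : ℝ) ≤ ∫ t, (logPlus.fn t ‖f (polarPt (r n) t)‖₊ : ℝ) ∂poissonMeasure w →
      (Φ.fn x y : ℝ≥0∞) ≤ C * G n) :
    Φ.eval x (logPlus.eval x (ntMax f x)) ≤ liminf (fun n => C * G n) atTop := by
  have hne : Nonempty (approachRegion x) :=
    ⟨⟨polarPt 0 (x + ((0 : ℝ) : UnitCirc)), 0, 0, le_rfl, one_pos, by norm_num, rfl⟩⟩
  have h1 : ntMax f x = ⨆ z : approachRegion x, (‖f z‖₊ : ℝ≥0∞) := by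
    rw [ntMax, iSup_subtype']; rfl
  have h2 : Φ.eval x (logPlus.eval x (ntMax f x)) ≤
      ⨆ z : approachRegion x, (Φ.fn x (logPlus.fn x ‖f z‖₊) : ℝ≥0∞) := by
    rw [h1]
    exact (Φ.eval_mono x (logPlus.eval_iSup_le (continuous_logPlus_fn x) _)).trans
      (Φ.eval_iSup_le (hΦ.continuous_fn x) _)
  refine h2.trans (iSup_le fun ⟨w, hw⟩ => ?_)
  have hw1 := norm_lt_one_of_mem_approachRegion hw
  -- For fixed `w`, `f(r_n w) → f(w)`, so the bounds for the dilates pass to the liminf; the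
  -- supremum over `w` has already been taken outside.
  have htend : Tendsto (fun n => (Φ.fn x (logPlus.fn x ‖f (r n * w)‖₊) : ℝ≥0∞)) atTop
      (𝓝 (Φ.fn x (logPlus.fn x ‖f w‖₊) : ℝ≥0∞)) := by
    have hc : ContinuousAt f w := (hf w (by simpa using hw1)).continuousAt
    have hrw : Tendsto (fun n => (r n : ℂ) * w) atTop (𝓝 w) := by
      have := ((Complex.continuous_ofReal.tendsto 1).comp hr1).mul_const w
      simpa using this
    exact (((ENNReal.continuous_coe.comp (hΦ.continuous_fn x)).comp
      (continuous_logPlus_fn x)).comp continuous_nnnorm).continuousAt.tendsto.comp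
      (hc.tendsto.comp hrw)
  rw [← htend.liminf_eq]
  refine liminf_le_liminf (.of_forall fun n => hG n w hw _ ?_)
  have hF : DiffContOnCl ℂ (fun z => f (r n * z)) (Metric.ball 0 1) := by
    refine DifferentiableOn.diffContOnCl fun z hz => ?_
    rw [closure_ball _ one_ne_zero, mem_closedBall_zero_iff] at hz
    have hz' : (r n : ℂ) * z ∈ Metric.ball (0 : ℂ) 1 := by
      rw [mem_ball_zero_iff, norm_mul, Complex.norm_real, Real.norm_eq_abs, abs_of_pos (hr n).1]
      calc r n * ‖z‖ ≤ r n * 1 := by gcongr; exact (hr n).1.le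
        _ < 1 := by linarith [(hr n).2]
    exact ((hf _ hz').differentiableAt.comp z
      ((differentiableAt_const _).mul differentiableAt_id)).differentiableWithinAt
  have := posLog_norm_le_integral_poissonMeasure hF hw1
  simp only [← polarPt_eq_mul_polarPt_one] at this
  simpa [logPlus, Real.posLog_nonneg] using this

/-- Boundedness of the nontangential maximal operator for the modular of `Ψ ∘ Φ ∘ log⁺`. -/
theorem exists_lintegral_ntMax_le (hs : Φ.SlowlyChanging) (hc : Φ.IsConvex)
    (hd : Ψ.UniformlyDoubling) (hHL : HLBounded Ψ) {A : ℝ≥0} (hA : 0 < A) :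
    ∃ B : ℝ≥0, 0 < B ∧ ∀ f : ℂ → ℂ, AnalyticOnNhd ℂ f (Metric.ball 0 1) →
      (Ψ.comp (Φ.comp logPlus)).hardyModular f ≤ A →
      ∫⁻ t : UnitCirc, Ψ.eval t (Φ.eval t (logPlus.eval t (ntMax f t))) ≤ B := by
  obtain ⟨B, hB0, hB⟩ := hHL.exists_of_aemeasurable hA
  -- Either the modular bound gives the integral bound `D`, or every modular of `Ψ` is at most `B`
  -- and nothing remains to prove.
  rcases exists_lintegral_le_or_forall_modular_le hB with ⟨D, hD⟩ | hall
  swap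
  · exact ⟨B, hB0, fun f _ _ => hall _⟩
  obtain ⟨C, hC⟩ := exists_fn_le_mul_dyadicMax hs hc D
  obtain ⟨K, hK⟩ := hd.exists_eval_liminf_le C
  refine ⟨K * B + 1, by positivity, fun f hf hfA => ?_⟩
  obtain ⟨r, -, hr, hr1⟩ := exists_seq_strictMono_tendsto' (zero_lt_one (α := ℝ))
  let u : ℕ → UnitCirc → ℝ≥0 := fun n t => logPlus.fn t ‖f (polarPt (r n) t)‖₊
  have hu : ∀ n, Continuous (u n) := fun n => by
    refine (continuous_logPlus_fn 0).comp (continuous_nnnorm.comp ?_)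
    refine hf.continuousOn.comp_continuous (continuous_polarPt _) fun t => ?_
    rw [mem_ball_zero_iff, norm_polarPt, abs_of_pos (hr n).1]
    exact (hr n).2
  have hg : ∀ n, AEMeasurable (fun t => Φ.fn t (u n t)) volume := fun n =>
    Φ.aemeasurable_fn _ (hu n).measurable
  have hgA : ∀ n, Ψ.modular (fun t => (Φ.fn t (u n t) : ℝ≥0∞)) ≤ A := fun n => by
    refine le_trans (lintegral_mono fun t => ?_) ((le_iSup₂ (r n) (hr n)).trans hfA)
    rw [eval_coe]
    exact ((Ψ.comp (Φ.comp logPlus)).eval_coe t ‖f (polarPt (r n) t)‖₊).ge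
  let G : ℕ → UnitCirc → ℝ≥0∞ := fun n => dyadicMax fun t => (Φ.fn t (u n t) : ℝ≥0∞)
  have hGm : ∀ n, Measurable (G n) := fun n => by
    have hae : (fun t => (Φ.fn t (u n t) : ℝ≥0∞)) =ᵐ[volume] fun t => (((hg n).mk _ t : ℝ≥0) : ℝ≥0∞) :=
      (hg n).ae_eq_mk.mono fun x hx => by simp only [hx]
    simp only [G, dyadicMax_congr_ae hae]
    exact measurable_dyadicMax (hg n).measurable_mk.coe_nnreal_ennreal
  have hGB : ∀ n, Ψ.modular (G n) ≤ B := fun n =>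
    (lintegral_mono fun x => Ψ.eval_mono x (dyadicMax_le_hlMax _ x)).trans
      (hB _ (hg n) (hgA n))
  calc ∫⁻ t : UnitCirc, Ψ.eval t (Φ.eval t (logPlus.eval t (ntMax f t)))
      ≤ ∫⁻ t : UnitCirc, K * liminf (fun n => Ψ.eval t (G n t)) atTop := by
        refine lintegral_mono fun t => le_trans (Ψ.eval_mono t ?_) (hK t _)
        exact eval_logPlus_ntMax_le_liminf hc hf hr hr1 fun n w hw y hy =>
          hC (u n) (hu n) (hD _ (hg n) (hgA n)) t w hw y hy
    _ = K * ∫⁻ t : UnitCirc, liminf (fun n => Ψ.eval t (G n t)) atTop :=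
        lintegral_const_mul' _ _ ENNReal.coe_ne_top
    _ ≤ K * liminf (fun n => Ψ.modular (G n)) atTop := by
        gcongr
        exact lintegral_liminf_le' fun n => Ψ.aemeasurable_eval (hGm n)
    _ ≤ K * B := by
        gcongr
        exact liminf_le_of_le (by isBoundedDefault) fun b hb => by
          obtain ⟨n, hn⟩ := hb.exists
          exact hn.trans (hGB n)
    _ ≤ _ := by push_cast; exact le_self_add

end ModularFamily

/-! ### The Hardy–Littlewood maximal operator on `L²` -/

theorem IsArc.exists_volume_ge_subset {I : Set UnitCirc} (hI : IsArc I) {x : UnitCirc}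
    (hx : x ∈ I) : ∃ l : ℝ, 0 < l ∧ l ≤ 2 * Real.pi ∧ ENNReal.ofReal l ≤ volume I ∧
      I ⊆ Metric.closedBall x l := by
  obtain ⟨a, b, hab, hba, h1, h2⟩ := hI
  refine ⟨b - a, by linarith, by linarith, ?_, fun y hy => ?_⟩
  · have hball : Metric.ball (((a + b) / 2 : ℝ) : UnitCirc) ((b - a) / 2) ⊆ I := by
      intro y hy
      obtain ⟨s, hs, hs'⟩ := UnitCirc.exists_coe_eq_abs_eq_norm (y - (((a + b) / 2 : ℝ) : UnitCirc))
      rw [mem_ball_iff_norm, ← hs', abs_lt] at hy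
      refine h1 ⟨(a + b) / 2 + s, ⟨by linarith, by linarith⟩, ?_⟩
      change (((a + b) / 2 + s : ℝ) : UnitCirc) = y
      rw [AddCircle.coe_add, hs]
      exact add_sub_cancel _ _
    refine le_trans (le_of_eq ?_) (measure_mono hball)
    rw [← measure_congr AddCircle.closedBall_ae_eq_ball, UnitCirc.volume_closedBall (by linarith)]
    congr 1
    ring
  · obtain ⟨s, hs, rfl⟩ := h2 hx
    obtain ⟨t, ht, rfl⟩ := h2 hy
    rw [mem_closedBall_iff_norm]
    change ‖((t - s : ℝ) : UnitCirc)‖ ≤ _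
    refine (UnitCirc.norm_coe_le _).trans ?_
    rw [abs_le]
    constructor <;> linarith [hs.1, hs.2, ht.1, ht.2]

/-- An arc of length `l` through `x` lies in a dyadic arc centred at `x` of radius at most `2l`,
thus of measure at most `4l`. -/
theorem hlMax_le_four_mul_dyadicMax (g : UnitCirc → ℝ≥0∞) (x : UnitCirc) :
    hlMax g x ≤ 4 * dyadicMax g x := by
  refine iSup₂_le fun I ⟨hI, hx⟩ => ?_
  obtain ⟨l, hl0, hlπ, hlI, hsub⟩ := hI.exists_volume_ge_subset hx
  obtain ⟨k, hk1, hk2⟩ : ∃ k, I ⊆ Metric.closedBall x (dyadicRadius k) ∧ dyadicRadius k ≤ 2 * l := by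
    rcases le_or_gt l Real.pi with h | h
    · obtain ⟨k, h1, h2⟩ := exists_dyadicRadius_mem_Ioc hl0 h
      exact ⟨k, hsub.trans (Metric.closedBall_subset_closedBall h1), h2.le⟩
    · refine ⟨0, fun y _ => ?_, by rw [dyadicRadius_zero]; linarith⟩
      rw [mem_closedBall_iff_norm, dyadicRadius_zero]
      exact UnitCirc.norm_le_pi _
  have hvol : volume (Metric.closedBall x (dyadicRadius k)) ≤ 4 * volume I := by
    calc _ = ENNReal.ofReal (2 * dyadicRadius k) := volume_closedBall_dyadicRadius x k
      _ ≤ ENNReal.ofReal (4 * l) := ENNReal.ofReal_le_ofReal (by linarith)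
      _ = 4 * ENNReal.ofReal l := by rw [ENNReal.ofReal_mul (by norm_num)]; norm_num
      _ ≤ _ := by gcongr
  calc (volume I)⁻¹ * ∫⁻ y in I, g y
      ≤ (4 * (volume (Metric.closedBall x (dyadicRadius k)))⁻¹) *
        ∫⁻ y in Metric.closedBall x (dyadicRadius k), g y := by
        refine mul_le_mul' ?_ (lintegral_mono_set hk1)
        rw [← div_eq_mul_inv, ENNReal.le_div_iff_mul_le (Or.inr (by norm_num))
          (Or.inl (measure_ne_top _ _)), ← ENNReal.div_eq_inv_mul]
        exact ENNReal.div_le_of_le_mul hvol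
    _ = 4 * ((volume (Metric.closedBall x (dyadicRadius k)))⁻¹ *
        ∫⁻ y in Metric.closedBall x (dyadicRadius k), g y) := mul_assoc _ _ _
    _ ≤ 4 * dyadicMax g x := by
        gcongr
        exact le_iSup (fun k : ℕ => (volume (Metric.closedBall x (dyadicRadius k)))⁻¹ *
          ∫⁻ y in Metric.closedBall x (dyadicRadius k), g y) k

/-- The weak type `(1, 1)` inequality. -/
theorem mul_volume_lt_dyadicMax_le (g : UnitCirc → ℝ≥0∞) (c : ℝ≥0∞) :
    c * volume {x | c < dyadicMax g x} ≤ 4 * ∫⁻ x, g x := by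
  have hk : ∀ x ∈ {x | c < dyadicMax g x}, ∃ k : ℕ,
      c * volume (Metric.closedBall x (dyadicRadius k)) ≤
        ∫⁻ y in Metric.closedBall x (dyadicRadius k), g y := fun x hx => by
    obtain ⟨k, hk⟩ := lt_iSup_iff.mp (show c < ⨆ k : ℕ, _ from hx)
    refine ⟨k, ?_⟩
    have h0 : volume (Metric.closedBall x (dyadicRadius k)) ≠ 0 := by
      rw [volume_closedBall_dyadicRadius]
      simpa using dyadicRadius_pos k
    rw [← ENNReal.div_eq_inv_mul] at hk
    exact ((ENNReal.le_div_iff_mul_le (Or.inl h0) (Or.inl (measure_ne_top _ _))).mp hk.le)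
  choose! k hk using hk
  -- Vitali's covering needs an enlargement factor above 3; 4 is chosen, and it becomes the
  -- weak-type constant.
  obtain ⟨u, hut, hdisj, hcov⟩ := Vitali.exists_disjoint_subfamily_covering_enlargement_closedBall
    {x | c < dyadicMax g x} id (fun x => dyadicRadius (k x)) Real.pi
    (fun x _ => dyadicRadius_le_pi _) 4 (by norm_num)
  simp only [id] at hdisj hcov
  have hu : u.Countable := hdisj.countable_of_nonempty_interior fun x _ =>
    ⟨x, Metric.ball_subset_interior_closedBall (Metric.mem_ball_self (dyadicRadius_pos _))⟩
  have hvol : ∀ x, volume (Metric.closedBall x (4 * dyadicRadius (k x))) ≤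
      4 * volume (Metric.closedBall x (dyadicRadius (k x))) := fun x => by
    rw [volume_closedBall_dyadicRadius, AddCircle.volume_closedBall,
      show (4 : ℝ≥0∞) = ENNReal.ofReal 4 by norm_num, ← ENNReal.ofReal_mul (by norm_num)]
    exact ENNReal.ofReal_le_ofReal ((min_le_right _ _).trans (by linarith))
  have hsub : {x | c < dyadicMax g x} ⊆
      ⋃ x ∈ u, Metric.closedBall x (4 * dyadicRadius (k x)) := fun x hx => by
    obtain ⟨b, hb, hb'⟩ := hcov x hx
    exact mem_biUnion hb (hb' (Metric.mem_closedBall_self (dyadicRadius_pos _).le))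
  have : Countable u := hu.to_subtype
  calc c * volume {x | c < dyadicMax g x}
      ≤ c * ∑' x : u, volume (Metric.closedBall (x : UnitCirc) (4 * dyadicRadius (k x))) := by
        gcongr
        exact (measure_mono hsub).trans (measure_biUnion_le _ hu _)
    _ ≤ c * ∑' x : u, 4 * volume (Metric.closedBall (x : UnitCirc) (dyadicRadius (k x))) := by
        gcongr with x
        exact hvol x
    _ = 4 * ∑' x : u, c * volume (Metric.closedBall (x : UnitCirc) (dyadicRadius (k x))) := by
        rw [ENNReal.tsum_mul_left, ENNReal.tsum_mul_left, mul_left_comm]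
    _ ≤ 4 * ∑' x : u, ∫⁻ y in Metric.closedBall (x : UnitCirc) (dyadicRadius (k x)), g y := by
        gcongr with x
        exact hk x (hut x.2)
    _ = 4 * ∫⁻ y in ⋃ x ∈ u, Metric.closedBall x (dyadicRadius (k x)), g y := by
        rw [lintegral_biUnion hu (fun x _ => Metric.isClosed_closedBall.measurableSet) hdisj]
    _ ≤ 4 * ∫⁻ x, g x := by gcongr; exact Measure.restrict_le_self

/-- Values of `g` up to `c / 2` contribute at most `c / 2` to any average, so the part of `g` above
`c / 2` must have maximal function above `c / 2`. The weak type bound at that level gives `8 = 2 ·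
4`. -/
theorem mul_volume_lt_dyadicMax_le_setLIntegral {g : UnitCirc → ℝ≥0∞} (hg : Measurable g)
    (c : ℝ≥0∞) :
    c * volume {x | c < dyadicMax g x} ≤ 8 * ∫⁻ x in {x | c / 2 < g x}, g x := by
  set S := {x | c / 2 < g x} with hS
  have hSm : MeasurableSet S := measurableSet_lt measurable_const hg
  have hle : ∀ x, dyadicMax g x ≤ dyadicMax (S.indicator g) x + c / 2 := fun x => by
    refine iSup_le fun k => ?_
    have hg' : ∀ y, g y ≤ S.indicator g y + c / 2 := fun y => by
      by_cases hy : y ∈ S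
      · rw [indicator_of_mem hy]; exact le_self_add
      · exact (not_lt.mp hy).trans le_add_self
    set I := Metric.closedBall x (dyadicRadius k) with hI
    calc (volume I)⁻¹ * ∫⁻ y in I, g y
        ≤ (volume I)⁻¹ * ∫⁻ y in I, (S.indicator g y + c / 2) := by
          gcongr with y
          exact hg' y
      _ = (volume I)⁻¹ * (∫⁻ y in I, S.indicator g y) + (volume I)⁻¹ * volume I * (c / 2) := by
          rw [lintegral_add_right _ measurable_const, setLIntegral_const]
          ring
      _ ≤ _ := by
          refine add_le_add (le_iSup (fun k : ℕ =>
            (volume (Metric.closedBall x (dyadicRadius k)))⁻¹ *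
            ∫⁻ y in Metric.closedBall x (dyadicRadius k), S.indicator g y) k) ?_
          exact (mul_le_mul_left (ENNReal.inv_mul_le_one _) _).trans_eq (one_mul _)
  have hsub : {x | c < dyadicMax g x} ⊆ {x | c / 2 < dyadicMax (S.indicator g) x} := fun x hx => by
    by_contra hn
    refine absurd (hx.trans_le (hle x)) (not_lt.mpr ?_)
    calc _ ≤ c / 2 + c / 2 := by gcongr; exact not_lt.mp hn
      _ = c := ENNReal.add_halves c
  calc c * volume {x | c < dyadicMax g x}
      ≤ 2 * (c / 2 * volume {x | c / 2 < dyadicMax (S.indicator g) x}) := by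
        rw [← mul_assoc, ENNReal.mul_div_cancel two_ne_zero ENNReal.ofNat_ne_top]
        gcongr
    _ ≤ 2 * (4 * ∫⁻ x, S.indicator g x) := mul_le_mul_right (mul_volume_lt_dyadicMax_le _ _) _
    _ = _ := by rw [lintegral_indicator hSm, ← mul_assoc]; norm_num

/-- A layer-cake bound: the levels in `(y/2, y)` alone contribute at least `(y/2)²`. Infinite `y` is
reached through finite `c ≤ y`. -/
theorem sq_le_four_mul_lintegral (y : ℝ≥0∞) :
    y ^ 2 ≤ 4 * ∫⁻ l in Ioi (0 : ℝ),
      {l : ℝ | ENNReal.ofReal l < y}.indicator (fun l => ENNReal.ofReal l) l := by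
  have key : ∀ c : ℝ≥0, (c : ℝ≥0∞) ≤ y → (c : ℝ≥0∞) ^ 2 ≤ 4 * ∫⁻ l in Ioi (0 : ℝ),
      {l : ℝ | ENNReal.ofReal l < y}.indicator (fun l => ENNReal.ofReal l) l := fun c hc => by
    calc (c : ℝ≥0∞) ^ 2 = 4 * ∫⁻ _ in Ioo ((c : ℝ) / 2) c, ENNReal.ofReal (c / 2) := by
          rw [setLIntegral_const, Real.volume_Ioo, ← ENNReal.ofReal_mul (by positivity),
            show (4 : ℝ≥0∞) = ENNReal.ofReal 4 by norm_num, ← ENNReal.ofReal_mul (by norm_num),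
            ← ENNReal.ofReal_coe_nnreal, ← ENNReal.ofReal_pow (by positivity)]
          congr 1
          ring
      _ ≤ 4 * ∫⁻ l in Ioo ((c : ℝ) / 2) c,
          {l : ℝ | ENNReal.ofReal l < y}.indicator (fun l => ENNReal.ofReal l) l := by
          gcongr 4 * ?_
          refine setLIntegral_mono' measurableSet_Ioo fun l hl => ?_
          rw [indicator_of_mem]
          · exact ENNReal.ofReal_le_ofReal hl.1.le
          · refine lt_of_lt_of_le ?_ hc
            rw [← ENNReal.ofReal_coe_nnreal, ENNReal.ofReal_lt_ofReal_iff_of_nonneg]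
            · exact hl.2
            · exact le_trans (by positivity) hl.1.le
      _ ≤ _ := by
          gcongr
          intro l hl
          exact lt_of_le_of_lt (by positivity) hl.1
  induction y with
  | coe y => exact key y le_rfl
  | top =>
    refine le_of_eq_of_le (ENNReal.top_pow two_ne_zero) (le_of_forall_lt fun a ha => ?_)
    lift a to ℝ≥0 using ha.ne
    refine lt_of_lt_of_le ?_ (key (a + 1) le_top)
    exact_mod_cast (lt_add_one a).trans_le (le_self_pow₀ le_add_self two_ne_zero)

/-- The maximal operator is bounded on `L²`. -/
theorem lintegral_dyadicMax_sq_le {g : UnitCirc → ℝ≥0} (hg : Measurable g) :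
    ∫⁻ x, dyadicMax (fun y => (g y : ℝ≥0∞)) x ^ 2 ≤ 64 * ∫⁻ x, (g x : ℝ≥0∞) ^ 2 := by
  set M := dyadicMax fun y => (g y : ℝ≥0∞) with hM
  have hgm : Measurable fun y => (g y : ℝ≥0∞) := hg.coe_nnreal_ennreal
  have hMm : Measurable M := measurable_dyadicMax hgm
  have hS : MeasurableSet {p : UnitCirc × ℝ | ENNReal.ofReal p.2 < M p.1} :=
    measurableSet_lt measurable_snd.ennreal_ofReal (hMm.comp measurable_fst)
  have hS' : MeasurableSet {p : UnitCirc × ℝ | ENNReal.ofReal p.2 / 2 < g p.1} :=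
    measurableSet_lt (measurable_snd.ennreal_ofReal.div_const _) (hgm.comp measurable_fst)
  calc ∫⁻ x, M x ^ 2
      ≤ ∫⁻ x, 4 * ∫⁻ l in Ioi (0 : ℝ), {p : UnitCirc × ℝ | ENNReal.ofReal p.2 < M p.1}.indicator
        (fun p => ENNReal.ofReal p.2) (x, l) := lintegral_mono fun x => sq_le_four_mul_lintegral _
    _ = 4 * ∫⁻ l in Ioi (0 : ℝ), ∫⁻ x, {p : UnitCirc × ℝ | ENNReal.ofReal p.2 < M p.1}.indicator
        (fun p => ENNReal.ofReal p.2) (x, l) := by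
        rw [lintegral_const_mul' _ _ (by norm_num), lintegral_lintegral_swap]
        exact (measurable_snd.ennreal_ofReal.indicator hS).aemeasurable
    _ ≤ 4 * ∫⁻ l in Ioi (0 : ℝ), 8 * ∫⁻ x, {p : UnitCirc × ℝ |
        ENNReal.ofReal p.2 / 2 < g p.1}.indicator (fun p => (g p.1 : ℝ≥0∞)) (x, l) := by
        gcongr with l
        calc _ = ∫⁻ x, {x | ENNReal.ofReal l < M x}.indicator (fun _ => ENNReal.ofReal l) x := rfl
          _ = ENNReal.ofReal l * volume {x | ENNReal.ofReal l < M x} := by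
            rw [lintegral_indicator (measurableSet_lt measurable_const hMm), setLIntegral_const]
          _ ≤ 8 * ∫⁻ x in {x | ENNReal.ofReal l / 2 < g x}, (g x : ℝ≥0∞) :=
            mul_volume_lt_dyadicMax_le_setLIntegral hgm _
          _ = _ := by
            rw [← lintegral_indicator (measurableSet_lt measurable_const hgm)]
            rfl
    _ = 32 * ∫⁻ x, ∫⁻ l in Ioi (0 : ℝ), {p : UnitCirc × ℝ |
        ENNReal.ofReal p.2 / 2 < g p.1}.indicator (fun p => (g p.1 : ℝ≥0∞)) (x, l) := by
        rw [lintegral_const_mul' _ _ (by norm_num), lintegral_lintegral_swap, ← mul_assoc]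
        · norm_num
        · exact (((hgm.comp measurable_fst).indicator hS').comp measurable_swap).aemeasurable
    _ ≤ 32 * ∫⁻ x, 2 * (g x : ℝ≥0∞) ^ 2 := by
        gcongr with x
        calc _ = ∫⁻ l in Ioi (0 : ℝ), {l : ℝ | ENNReal.ofReal l / 2 < g x}.indicator
              (fun _ => (g x : ℝ≥0∞)) l := rfl
          -- Only levels `l < 2 g(x)` count, so the inner integral is at most `2 g(x)²`.
          _ ≤ ∫⁻ l, (Ioo (0 : ℝ) (2 * g x)).indicator (fun _ => (g x : ℝ≥0∞)) l := by
            rw [← lintegral_indicator measurableSet_Ioi, indicator_indicator]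
            refine lintegral_mono (indicator_le_indicator_of_subset ?_ fun _ => zero_le)
            rintro l ⟨hl0, hl⟩
            refine ⟨hl0, ?_⟩
            rw [mem_ofPred_eq, ENNReal.div_lt_iff (by norm_num) (by norm_num), mul_comm] at hl
            have h2 : (2 : ℝ≥0∞) * g x = ENNReal.ofReal (2 * g x) := by
              rw [ENNReal.ofReal_mul (by norm_num)]; simp
            rw [h2] at hl
            exact (ENNReal.ofReal_lt_ofReal_iff_of_nonneg (le_of_lt hl0)).mp hl
          _ = 2 * (g x : ℝ≥0∞) ^ 2 := by
            rw [lintegral_indicator measurableSet_Ioo, setLIntegral_const, Real.volume_Ioo,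
              sub_zero, ENNReal.ofReal_mul (by norm_num)]
            simp only [ENNReal.ofReal_ofNat, ENNReal.ofReal_coe_nnreal]
            ring
    _ = 64 * ∫⁻ x, (g x : ℝ≥0∞) ^ 2 := by
        rw [lintegral_const_mul' _ _ (by norm_num), ← mul_assoc]
        norm_num

/-! ### Constant families: the square and the exponential -/

namespace ModularFamily

/-- The modular family all of whose members are the same function. -/
def const (φ : ℝ≥0 → ℝ≥0) (hφ : Monotone φ) : ModularFamily where
  fn _ := φ
  upper _ := φ
  lower _ := φ
  fn_mono _ := hφ
  upper_mono _ _ := hφ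
  lower_mono _ _ := hφ
  lower_le_fn _ _ _ _ _ := le_rfl
  fn_le_upper _ _ _ _ _ := le_rfl
  upper_closure _ _ := rfl
  lower_closure _ _ := rfl
  upper_subset _ _ _ _ _ _ := le_rfl
  lower_subset _ _ _ _ _ _ := le_rfl
  aemeasurable_fn _ hg := (hφ.measurable.comp hg).aemeasurable

variable {φ : ℝ≥0 → ℝ≥0} {hφ : Monotone φ}

theorem eq_of_mem_members_const {ψ : ℝ≥0 → ℝ≥0} (h : ψ ∈ (const φ hφ).members) : ψ = φ := by
  rcases h with ⟨x, rfl⟩ | ⟨I, -, rfl | rfl⟩ <;> rfl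

theorem slowlyChanging_const : (const φ hφ).SlowlyChanging := fun _ _ =>
  ⟨1, one_pos, fun _ _ w _ => (one_mul (φ w)).ge⟩

/-- The constant family of the function `s ↦ s²`. -/
def square : ModularFamily := const (fun s => s ^ 2) fun _ _ h => pow_le_pow_left' h 2

theorem square_eval (x : UnitCirc) (y : ℝ≥0∞) : square.eval x y = y ^ 2 := by
  induction y with
  | coe y => rw [eval_coe]; simp [square, const]
  | top =>
    rw [ENNReal.top_pow two_ne_zero, eq_top_iff]
    refine le_of_forall_lt fun a ha => ?_
    lift a to ℝ≥0 using ha.ne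
    refine lt_of_lt_of_le ?_ (le_iSup₂_of_le (a + 1) le_top le_rfl)
    exact ENNReal.coe_lt_coe.mpr ((lt_add_one a).trans_le (le_self_pow₀ le_add_self two_ne_zero))

theorem uniformlyDoubling_square : square.UniformlyDoubling := by
  refine ⟨4, fun ψ hψ t => ?_⟩
  rw [eq_of_mem_members_const hψ]
  refine le_of_eq ?_
  change (2 * t) ^ 2 = 4 * t ^ 2
  rw [mul_pow]
  norm_num

theorem hlBounded_square : HLBounded square := by
  -- `1024 = 4² · 64`: the squared comparison constant of the two maximal functions times the `L²`
  -- constant.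
  refine fun A hA => ⟨1024 * A, by positivity, fun g hg hgA => ?_⟩
  simp only [modular, square_eval] at hgA ⊢
  calc ∫⁻ x, hlMax (fun x => (g x : ℝ≥0∞)) x ^ 2
      ≤ ∫⁻ x, 16 * dyadicMax (fun x => (g x : ℝ≥0∞)) x ^ 2 := by
        refine lintegral_mono fun x => ?_
        calc _ ≤ (4 * dyadicMax (fun x => (g x : ℝ≥0∞)) x) ^ 2 := by
              gcongr; exact hlMax_le_four_mul_dyadicMax _ x
          _ = _ := by rw [mul_pow]; norm_num
    _ ≤ 16 * (64 * A) := by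
        rw [lintegral_const_mul' _ _ (by norm_num)]
        gcongr
        exact (lintegral_dyadicMax_sq_le hg).trans (by gcongr)
    _ = _ := by push_cast; rw [← mul_assoc]; norm_num

/-- The constant family of the function `s ↦ exp (q s) - 1`. -/
def expSubOne (q : ℝ≥0) : ModularFamily :=
  const (fun s => (Real.exp (q * s) - 1).toNNReal) fun _ _ h =>
    Real.toNNReal_le_toNNReal (sub_le_sub_right (Real.exp_le_exp.mpr (by gcongr)) 1)

theorem coe_expSubOne_fn (q : ℝ≥0) (x : UnitCirc) (s : ℝ≥0) :
    ((expSubOne q).fn x s : ℝ) = Real.exp (q * s) - 1 :=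
  Real.coe_toNNReal _ (sub_nonneg.mpr (Real.one_le_exp (by positivity)))

theorem isConvex_expSubOne (q : ℝ≥0) : (expSubOne q).IsConvex := by
  intro ψ hψ
  rw [eq_of_mem_members_const hψ]
  refine ⟨convex_univ, fun s _ t _ a b _ _ hab => ?_⟩
  have hab' : (a : ℝ) + b = 1 := by rw [← NNReal.coe_add, hab, NNReal.coe_one]
  have h := convexOn_exp.2 (mem_univ (q * s : ℝ)) (mem_univ (q * t : ℝ)) a.coe_nonneg b.coe_nonneg
    hab'
  have h2 : (a : ℝ) • (q * s : ℝ) + (b : ℝ) • (q * t : ℝ) = q * ((a * s + b * t : ℝ≥0) : ℝ) := by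
    simp only [smul_eq_mul, NNReal.coe_add, NNReal.coe_mul]
    ring
  rw [h2] at h
  have e := coe_expSubOne_fn q 0
  change (expSubOne q).fn 0 (a * s + b * t) ≤
    a * (expSubOne q).fn 0 s + b * (expSubOne q).fn 0 t
  rw [← NNReal.coe_le_coe, NNReal.coe_add, NNReal.coe_mul, NNReal.coe_mul, e, e, e]
  simp only [smul_eq_mul] at h
  linarith

theorem expSubOne_fn_logPlus (q : ℝ≥0) (x : UnitCirc) (s : ℝ≥0) :
    ((expSubOne q).fn x (logPlus.fn x s) : ℝ) = max 1 (s : ℝ) ^ (q : ℝ) - 1 := by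
  rw [coe_expSubOne_fn]
  congr 1
  change Real.exp (q * (Real.posLog s).toNNReal) = _
  rw [Real.coe_toNNReal _ Real.posLog_nonneg, Real.posLog_eq_log_max_one (NNReal.coe_nonneg s),
    Real.rpow_def_of_pos (by positivity), mul_comm]

end ModularFamily

/-! ### Nontangential maximal functions in `H^p` -/

open ModularFamily

theorem ntMax_const_mul (a : ℂ) (f : ℂ → ℂ) (θ : UnitCirc) :
    ntMax (fun z => a * f z) θ = ‖a‖ₑ * ntMax f θ := by
  simp only [ntMax, enorm_mul, ENNReal.mul_iSup]

theorem hardyNorm_const_mul (p : ℝ≥0∞) (a : ℂ) (f : ℂ → ℂ) :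
    hardyNorm p (fun z => a * f z) = ‖a‖ₑ * hardyNorm p f := by
  simp only [hardyNorm, ENNReal.mul_iSup]
  congr! 4 with r hr
  exact eLpNorm_const_smul a _ _ _

/-- The exponent is `p / 2` because the outer function is the square, for which the maximal operator
is bounded; every `p > 0` is thereby covered. -/
theorem expSubOne_logPlus_sq_le (p : ℝ≥0) (x : UnitCirc) (s : ℝ≥0) :
    (expSubOne (p / 2)).fn x (logPlus.fn x s) ^ 2 ≤ s ^ (p : ℝ) := by
  rw [← NNReal.coe_le_coe, NNReal.coe_pow, NNReal.coe_rpow, expSubOne_fn_logPlus, NNReal.coe_div,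
    NNReal.coe_ofNat]
  rcases le_total (s : ℝ) 1 with h | h
  · rw [max_eq_left h, Real.one_rpow]
    simp only [sub_self, ne_eq, OfNat.ofNat_ne_zero, not_false_eq_true, zero_pow]
    positivity
  · rw [max_eq_right h]
    have h1 : 1 ≤ (s : ℝ) ^ ((p : ℝ) / 2) := Real.one_le_rpow h (by positivity)
    have h2 : (s : ℝ) ^ (p : ℝ) = ((s : ℝ) ^ ((p : ℝ) / 2)) ^ 2 := by
      rw [← Real.rpow_natCast, ← Real.rpow_mul s.coe_nonneg]
      congr 1
      push_cast
      ring
    rw [h2]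
    exact pow_le_pow_left₀ (by linarith) (by linarith) 2

theorem rpow_le_two_mul_expSubOne_logPlus_sq_add (p : ℝ≥0) (x : UnitCirc) (s : ℝ≥0) :
    s ^ (p : ℝ) ≤ 2 * (expSubOne (p / 2)).fn x (logPlus.fn x s) ^ 2 + 2 := by
  rw [← NNReal.coe_le_coe, NNReal.coe_add, NNReal.coe_mul, NNReal.coe_pow, NNReal.coe_rpow,
    expSubOne_fn_logPlus, NNReal.coe_div, NNReal.coe_ofNat]
  set m := max 1 (s : ℝ) with hm
  have h2 : m ^ (p : ℝ) = (m ^ ((p : ℝ) / 2)) ^ 2 := by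
    rw [← Real.rpow_natCast, ← Real.rpow_mul (by positivity)]
    congr 1
    push_cast
    ring
  have h3 : (s : ℝ) ^ (p : ℝ) ≤ m ^ (p : ℝ) :=
    Real.rpow_le_rpow s.coe_nonneg (le_max_right _ _) p.coe_nonneg
  -- With `a = m^{p/2}`, `2(a - 1)² + 2 - a² = (a - 2)²`.
  nlinarith [sq_nonneg (m ^ ((p : ℝ) / 2) - 2)]

theorem ENNReal.rpow_le_two_mul_eval_add {p : ℝ≥0} (hp : p ≠ 0) (x : UnitCirc) (y : ℝ≥0∞) :
    y ^ (p : ℝ) ≤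
      2 * square.eval x ((expSubOne (p / 2)).eval x (logPlus.eval x y)) + 2 := by
  have key : ∀ s : ℝ≥0, (s : ℝ≥0∞) ^ (p : ℝ) ≤
      2 * square.eval x ((expSubOne (p / 2)).eval x (logPlus.eval x s)) + 2 := fun s => by
    rw [eval_coe, eval_coe, square_eval, ← ENNReal.coe_rpow_of_nonneg _ p.coe_nonneg]
    exact_mod_cast rpow_le_two_mul_expSubOne_logPlus_sq_add p x s
  induction y with
  | coe y => exact key y
  | top =>
    have hp' : 0 < (p : ℝ) := by positivity
    rw [ENNReal.top_rpow_of_pos hp']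
    refine le_of_forall_lt fun a ha => ?_
    lift a to ℝ≥0 using ha.ne
    -- The test value has `p`-th power `a + 1`, so the right-hand side exceeds every finite `a`.
    have h1 := key ((a + 1) ^ (p : ℝ)⁻¹)
    rw [← ENNReal.coe_rpow_of_nonneg _ p.coe_nonneg, ← NNReal.rpow_mul, inv_mul_cancel₀ hp'.ne',
      NNReal.rpow_one] at h1
    refine lt_of_lt_of_le (ENNReal.coe_lt_coe.mpr (lt_add_one a)) (h1.trans ?_)
    gcongr
    exact square.eval_mono x ((expSubOne (p / 2)).eval_mono x (logPlus.eval_mono x le_top))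

/-- An analytic function is bounded by its `H^∞` norm. -/
theorem enorm_le_hardyNorm_top {f : ℂ → ℂ} (hf : AnalyticOnNhd ℂ f (Metric.ball 0 1)) {w : ℂ}
    (hw : ‖w‖ < 1) : ‖f w‖ₑ ≤ hardyNorm ∞ f := by
  obtain ⟨r, hwr, hr1⟩ := exists_between hw
  have hr0 : 0 < r := (norm_nonneg w).trans_lt hwr
  have hc : Continuous fun t : UnitCirc => f (polarPt r t) := by
    refine hf.continuousOn.comp_continuous (continuous_polarPt _) fun t => ?_
    rwa [mem_ball_zero_iff, norm_polarPt, abs_of_pos hr0]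
  set M := eLpNorm (fun t : UnitCirc => f (polarPt r t)) ∞ volume with hM
  have hall : ∀ t : UnitCirc, ‖f (polarPt r t)‖ₑ ≤ M := by
    -- An open null set of the circle is empty, so by continuity the essential bound holds at every
    -- point.
    have h0 : (volume : Measure UnitCirc) {t : UnitCirc | M < ‖f (polarPt r t)‖ₑ} = 0 := by
      have := ae_le_eLpNormEssSup (f := fun t : UnitCirc => f (polarPt r t)) (μ := volume)
      rw [← eLpNorm_exponent_top, ← hM, ae_iff] at this
      simpa only [not_le] using this
    have hopen : IsOpen {t : UnitCirc | M < ‖f (polarPt r t)‖ₑ} :=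
      isOpen_lt continuous_const hc.enorm
    rw [hopen.measure_eq_zero_iff volume] at h0
    intro t
    by_contra! ht
    exact (h0 ▸ ht : t ∈ (∅ : Set UnitCirc))
  refine le_trans ?_ (le_iSup₂_of_le r ⟨hr0, hr1⟩ le_rfl)
  rw [← hM]
  induction hMt : M with
  | top => exact le_top
  | coe M' =>
    rw [enorm_le_coe]
    refine Complex.norm_le_of_forall_mem_frontier_norm_le (U := Metric.ball 0 r)
      Metric.isBounded_ball (f := f) ?_ ?_ (subset_closure (by simpa using hwr))
    · refine DifferentiableOn.diffContOnCl fun z hz => ?_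
      rw [closure_ball _ hr0.ne', mem_closedBall_zero_iff] at hz
      exact (hf z (by simpa using hz.trans_lt hr1)).differentiableAt.differentiableWithinAt
    · intro z hz
      rw [frontier_ball _ hr0.ne', mem_sphere_zero_iff_norm] at hz
      obtain ⟨t, ht⟩ := exists_polarPt_one_eq (z := z / r) (by
        rw [norm_div, hz, Complex.norm_real, Real.norm_eq_abs, abs_of_pos hr0, div_self hr0.ne'])
      have hz' : polarPt r t = z := by
        rw [polarPt_eq_mul_polarPt_one, ht, mul_div_cancel₀]
        exact_mod_cast hr0.ne'
      have := hall t
      rwa [hz', hMt, enorm_le_coe] at this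

theorem eLpNorm_ntMax_top_le {f : ℂ → ℂ} (hf : AnalyticOnNhd ℂ f (Metric.ball 0 1)) :
    eLpNorm (ntMax f) ∞ (volume : Measure UnitCirc) ≤ hardyNorm ∞ f := by
  rw [eLpNorm_exponent_top]
  refine essSup_le_of_ae_le _ (.of_forall fun t => ?_)
  exact iSup₂_le fun w hw => enorm_le_hardyNorm_top hf (norm_lt_one_of_mem_approachRegion hw)

theorem exists_eLpNorm_ntMax_le_of_hardyNorm_le_one {p : ℝ≥0} (hp : p ≠ 0) :
    ∃ C : ℝ≥0, 0 < C ∧ ∀ f : ℂ → ℂ, AnalyticOnNhd ℂ f (Metric.ball 0 1) →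
      hardyNorm p f ≤ 1 → eLpNorm (ntMax f) p (volume : Measure UnitCirc) ≤ C := by
  obtain ⟨B, hB0, hB⟩ := exists_lintegral_ntMax_le (Φ := expSubOne (p / 2)) slowlyChanging_const
    (isConvex_expSubOne _) uniformlyDoubling_square hlBounded_square one_pos
  have hp' : (p : ℝ≥0∞) ≠ 0 := by exact_mod_cast hp
  refine ⟨(2 * B + 2 * (2 * Real.pi).toNNReal) ^ (1 / (p : ℝ)), by positivity, fun f hf hf1 => ?_⟩
  have h1 : (square.comp ((expSubOne (p / 2)).comp logPlus)).hardyModular f ≤ (1 : ℝ≥0) := by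
    refine iSup₂_le fun r hr => ?_
    have h2 : eLpNorm (fun x : UnitCirc => f (polarPt r x)) p volume ≤ 1 :=
      (le_iSup₂ (f := fun (r : ℝ) (_ : r ∈ Ioo (0 : ℝ) 1) =>
        eLpNorm (fun x : UnitCirc => f (polarPt r x)) p volume) r hr).trans hf1
    rw [eLpNorm_eq_lintegral_rpow_enorm_toReal hp' ENNReal.coe_ne_top, ENNReal.coe_toReal,
      ← ENNReal.one_rpow (1 / (p : ℝ)), ENNReal.rpow_le_rpow_iff (by positivity)] at h2
    refine le_trans (lintegral_mono fun x => ?_) h2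
    have h3 := (square.comp ((expSubOne (p / 2)).comp logPlus)).eval_coe x ‖f (polarPt r x)‖₊
    refine h3.trans_le ?_
    change _ ≤ (‖f (polarPt r x)‖₊ : ℝ≥0∞) ^ (p : ℝ)
    rw [← ENNReal.coe_rpow_of_nonneg _ p.coe_nonneg]
    exact ENNReal.coe_le_coe.mpr (expSubOne_logPlus_sq_le p x _)
  rw [eLpNorm_eq_lintegral_rpow_enorm_toReal hp' ENNReal.coe_ne_top, ENNReal.coe_toReal,
    ENNReal.coe_rpow_of_nonneg _ (by positivity)]
  gcongr
  calc ∫⁻ t, ‖ntMax f t‖ₑ ^ (p : ℝ)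
      ≤ ∫⁻ t : UnitCirc, (2 * square.eval t ((expSubOne (p / 2)).eval t
          (logPlus.eval t (ntMax f t))) + 2) :=
        lintegral_mono fun t => ENNReal.rpow_le_two_mul_eval_add hp t _
    _ ≤ 2 * B + 2 * ENNReal.ofReal (2 * Real.pi) := by
        rw [lintegral_add_right _ measurable_const, lintegral_const_mul' _ _ (by norm_num),
          lintegral_const, AddCircle.measure_univ]
        gcongr
        exact hB f hf h1
    _ = _ := by push_cast; rfl

/-- Both sides are homogeneous in `f`, so the bound on the unit ball of `H^p` suffices for finite
`p`. -/
theorem exists_eLpNorm_ntMax_le {p : ℝ≥0∞} (hp : p ≠ 0) :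
    ∃ C : ℝ≥0, ∀ f : ℂ → ℂ, AnalyticOnNhd ℂ f (Metric.ball 0 1) →
      eLpNorm (ntMax f) p (volume : Measure UnitCirc) ≤ C * hardyNorm p f := by
  induction p with
  | top => exact ⟨1, fun f hf => by simpa using eLpNorm_ntMax_top_le hf⟩
  | coe p =>
  obtain ⟨C, hC0, hC⟩ := exists_eLpNorm_ntMax_le_of_hardyNorm_le_one
    (p := p) (by exact_mod_cast hp)
  refine ⟨C, fun f hf => ?_⟩
  have hscale : ∀ a : ℝ≥0, a * hardyNorm p f ≤ 1 →
      a * eLpNorm (ntMax f) p (volume : Measure UnitCirc) ≤ C := fun a ha => by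
    have hae : ‖((a : ℝ) : ℂ)‖ₑ = a := by
      rw [← enorm_norm, Complex.norm_real]
      simp
    have h1 := hC (fun z => ((a : ℝ) : ℂ) * f z) (analyticOnNhd_const.mul hf)
      (by rwa [hardyNorm_const_mul, hae])
    have h2 : ntMax (fun z => ((a : ℝ) : ℂ) * f z) = a • ntMax f := by
      ext θ
      rw [ntMax_const_mul, hae]
      rfl
    rw [h2] at h1
    refine le_trans (le_of_eq ?_) h1
    rw [eLpNorm_eq_lintegral_rpow_enorm_toReal hp ENNReal.coe_ne_top,
      eLpNorm_eq_lintegral_rpow_enorm_toReal hp ENNReal.coe_ne_top]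
    have hp' : 0 < (p : ℝ) := by
      have : p ≠ 0 := by exact_mod_cast hp
      positivity
    have h3 : ∀ t, ‖(a • ntMax f) t‖ₑ ^ (p : ℝ) = (a : ℝ≥0∞) ^ (p : ℝ) * ‖ntMax f t‖ₑ ^ (p : ℝ) :=
      fun t => ENNReal.mul_rpow_of_nonneg _ _ hp'.le
    simp only [ENNReal.coe_toReal, h3]
    rw [lintegral_const_mul' _ _ (ENNReal.rpow_ne_top_of_nonneg hp'.le ENNReal.coe_ne_top),
      ENNReal.mul_rpow_of_nonneg _ _ (by positivity), ← ENNReal.rpow_mul, mul_one_div_cancel hp'.ne',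
      ENNReal.rpow_one]
  rcases eq_or_ne (hardyNorm p f) ∞ with htop | htop
  · rw [htop, ENNReal.mul_top (by exact_mod_cast hC0.ne')]
    exact le_top
  lift hardyNorm p f to ℝ≥0 using htop with H
  -- If the Hardy norm vanishes, every multiple of `f` lies in the unit ball; the factor `(C + 1) /
  -- E` would then contradict the bound `C`.
  rcases eq_or_ne H 0 with rfl | hH
  · rw [ENNReal.coe_zero, mul_zero, nonpos_iff_eq_zero]
    have hle : ∀ a : ℝ≥0, a * eLpNorm (ntMax f) p (volume : Measure UnitCirc) ≤ C := fun a =>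
      hscale a (by simp)
    by_contra h0
    have hE : eLpNorm (ntMax f) p (volume : Measure UnitCirc) ≠ ∞ := fun h => by
      simpa [h] using hle 1
    lift eLpNorm (ntMax f) p (volume : Measure UnitCirc) to ℝ≥0 using hE with E
    have hE0 : E ≠ 0 := by exact_mod_cast h0
    have := hle ((C + 1) / E)
    rw [← ENNReal.coe_mul, div_mul_cancel₀ _ hE0, ENNReal.coe_le_coe] at this
    exact absurd this (not_le.mpr (lt_add_one C))
  · have := hscale H⁻¹ (by rw [← ENNReal.coe_mul, inv_mul_cancel₀ hH, ENNReal.coe_one])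
    rw [ENNReal.coe_inv hH, ← ENNReal.div_eq_inv_mul] at this
    exact (ENNReal.div_le_iff (by exact_mod_cast hH) ENNReal.coe_ne_top).mp this

end

theorem theorem7p1 :
    (∀ Φ Ψ : ModularFamily,
      Φ.SlowlyChanging → Φ.IsConvex → Φ.Superlinear →
      Ψ.UniformlyDoubling → HLBounded Ψ →
      ∀ A : ℝ≥0, 0 < A → ∃ B : ℝ≥0, 0 < B ∧
        ∀ f : ℂ → ℂ, AnalyticOnNhd ℂ f (Metric.ball 0 1) →
          (Ψ.comp (Φ.comp ModularFamily.logPlus)).hardyModular f ≤ A →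
          ∫⁻ t : UnitCirc,
            Ψ.eval t (Φ.eval t (ModularFamily.logPlus.eval t (ntMax f t))) ≤ B) ∧
    (∀ p : ℝ≥0∞, p ≠ 0 → ∃ C : ℝ≥0,
      ∀ f : ℂ → ℂ, AnalyticOnNhd ℂ f (Metric.ball 0 1) →
        eLpNorm (ntMax f) p (volume : Measure UnitCirc) ≤ C * hardyNorm p f) :=
  ⟨fun _ _ hs hc _ hd hHL _ hA => ModularFamily.exists_lintegral_ntMax_le hs hc hd hHL hA,
    fun _ hp => exists_eLpNorm_ntMax_le hp⟩
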